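/- Graphs are finite and simple. For a graph $\Gamma$ with vertex set $V$, the right-angled Coxeter group (RACG) based on $\Gamma$ is $G(\Gamma)=\langle s\in V \mid s^2=1 \text{ for } s\in V,\ (ss')^2=1 \text{ for every edge } \{s,s'\}\rangle$. Its geodesic growth series is $\sum_{m\ge 0} f(m)t^m$, where $f(m)$ is the number of words of length $m$ over $V$ that are geodesic, i.e. whose length equals the word length (with respect to $V$) of the element of $G(\Gamma)$ they represent. Two graphs are co-spectral if their adjacency matrices have the same characteristic polynomial. The coalescence $\tau\cdot\sigma$ of two rooted trees is the tree obtained from their disjoint union by identifying the two roots. Let $S_1$ and $S_2$ be Godsil's trees on the vertex set $\{0,1,\dots,10\}$, rooted at $0$, where $S_1$ has the edges $01, 02, 13, 24, 25, 36, \{5,10\}, \{10,7\}, 78, 79$ and $S_2$ has the edges $\{0,10\}, \{10,1\}, 02, 13, 14, 25, 26, 37, 78, 89$. **Theorem.** Let $n\ge 12$. For every rooted tree $\tau$ on $n-10$ vertices, with any choice of root, $\Gamma_1=\tau\cdot S_1$ and $\Gamma_2=\tau\cdot S_2$ are trees on $n$ vertices such that 1. $\Gamma_1$ and $\Gamma_2$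 are not isomorphic, but are co-spectral and have co-spectral complements; and 2. the RACGs $G(\Gamma_1)$ and $G(\Gamma_2)$ have distinct geodesic growth series. In particular, for every $n\ge 12$ there are two non-isomorphic co-spectral trees on $n$ vertices with co-spectral complements whose RACGs have distinct geodesic growth series; so the spectrum of a tree does not determine the geodesic growth of its RACG. -/

import Mathlib

/-- The coalescence of the rooted graphs `(G, r)` and `(H, s)`: their disjoint union with the
roots `r` and `s` identified (the root `s` of `H` is represented by `r`). -/
def coalescence {V W : Type*} (G : SimpleGraph V) (r : V) (H : SimpleGraph W) (s : W) :
    SimpleGraph (V ⊕ {w : W // w ≠ s}) where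
  Adj
    | .inl a, .inl b => G.Adj a b
    | .inr a, .inr b => H.Adj a b
    | .inl a, .inr b => a = r ∧ H.Adj s b
    | .inr a, .inl b => b = r ∧ H.Adj s a
  symm := ⟨by
    rintro (a | a) (b | b) h
    · exact SimpleGraph.Adj.symm h
    · exact h
    · exact h
    · exact SimpleGraph.Adj.symm h⟩
  loopless := ⟨by
    rintro (a | a) h
    · exact G.irrefl h
    · exact H.irrefl h⟩

/-- Godsil's first tree; its root is the vertex `0`. -/
def godsilS₁ : SimpleGraph (Fin 11) :=
  SimpleGraph.fromEdgeSet
    {s(0, 1), s(0, 2), s(1, 3), s(2, 4), s(2, 5), s(3, 6), s(5, 10), s(10, 7), s(7, 8), s(7, 9)}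

/-- Godsil's second tree; its root is the vertex `0`. -/
def godsilS₂ : SimpleGraph (Fin 11) :=
  SimpleGraph.fromEdgeSet
    {s(0, 10), s(10, 1), s(0, 2), s(1, 3), s(1, 4), s(2, 5), s(2, 6), s(3, 7), s(7, 8), s(8, 9)}

open Classical in
/-- Two finite graphs are co-spectral if their adjacency matrices have the same characteristic
polynomial. -/
def Cospectral {V W : Type*} [Fintype V] [Fintype W] (G : SimpleGraph V) (H : SimpleGraph W) :
    Prop :=
  (G.adjMatrix ℤ).charpoly = (H.adjMatrix ℤ).charpoly

open Classical in
/-- The Coxeter matrix of the right-angled Coxeter group based on `G`: distinct generators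
commute exactly when they are adjacent; the entry `0` means that there is no relation. -/
noncomputable def racgMatrix {V : Type*} (G : SimpleGraph V) : CoxeterMatrix V where
  M := Matrix.of fun a b => if a = b then 1 else if G.Adj a b then 2 else 0
  isSymm := by
    ext a b
    simp [eq_comm, G.adj_comm]
  diagonal := by simp
  off_diagonal := by
    intro a b h
    simp only [Matrix.of_apply, if_neg h]
    split_ifs <;> decide

/-- The right-angled Coxeter group based on `G`, that is
`⟨s ∈ V ∣ s² = 1, (s s')² = 1 for all edges {s, s'}⟩`. -/
abbrev RACG {V : Type*} (G : SimpleGraph V) : Type _ := (racgMatrix G).Group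

/-- The standard generating set `V` of the right-angled Coxeter group based on `G`. -/
noncomputable def racgSystem {V : Type*} (G : SimpleGraph V) : CoxeterSystem (racgMatrix G) (RACG G) :=
  (racgMatrix G).toCoxeterSystem

/-- A word in the vertices of `G` is geodesic in the right-angled Coxeter group based on `G` if
its length equals the word length of the group element it represents. -/
def IsGeodesicWord {V : Type*} (G : SimpleGraph V) (w : List V) : Prop :=
  (racgSystem G).length ((racgSystem G).wordProd w) = w.length

/-- The number of geodesic words of length `m` in the right-angled Coxeter group based on `G`. -/
noncomputable def geodesicGrowth {V : Type*} (G : SimpleGraph V) (m : ℕ) : ℕ :=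
  Set.ncard {w : List V | w.length = m ∧ IsGeodesicWord G w}

/-- The geodesic growth series of the right-angled Coxeter group based on `G`. -/
noncomputable def geodesicGrowthSeries {V : Type*} (G : SimpleGraph V) : PowerSeries ℕ :=
  PowerSeries.mk (geodesicGrowth G)

/-! A word is geodesic exactly when no two equal letters can be brought together by commutations.
This holds because the group acts on such reduced words modulo commutation, and the orbit of the
empty word recovers every reduced word (`isGeodesicWord_iff`). Whether a letter may be put in front
of a reduced word depends only on its set of leading letters, so growth is counted by a recursion on
these sets (`ncard_extSet`).

In a triangle-free graph the recursion closes on singletons and edges. Eliminating the edge series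
leaves one linear system on the vertices, `growthOp G z = 1`, where the operator combines the
identity, the degree matrix and the adjacency matrix. For a fixed number of vertices, equal growth
series force equal sums of the solutions (`sum_eq_of_geodesicGrowthSeries_eq`).

The operator is symmetric and is the identity modulo `X`. Hence the solution on a Godsil branch is,
modulo `X ^ 8`, affine in its root value, with coefficients that do not depend on `τ`. Symmetry on
`τ` reduces the difference of the sums over `τ` to root terms (`sum_inl_sub_sum_inl`). If the two
totals agreed, `X ^ 6 * (2 - 8 * X - (1 - 3 * X) * (z + y))` would vanish modulo `X ^ 8`, with `z`,
`y` the two root values. Both have constant term 1, so degree 6 cancels; the coefficient in degree 7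
is `-2 * d`, where `d` is the degree of the root in `τ`. Since `τ` has at least two vertices, `d` is
positive, a contradiction. Non-isomorphism follows, growth being an isomorphism invariant.

Co-spectrality is independent of this: an explicit multiple of an orthogonal matrix intertwines the
two Godsil trees and scales the root vector and the all-one vector by 7. It therefore extends by a
scalar block over `τ`, and it respects complements. -/

/-! ### Geodesic words are the words reduced up to commutation -/

section Words

variable {V : Type*} (G : SimpleGraph V)

/-- The letter `s` can be moved to the front of the word by commutations along edges of `G`. -/
def Leads (s : V) : List V → Prop
  | [] => False
  | c :: w => s = c ∨ (G.Adj s c ∧ Leads s w)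

/-- No two occurrences of a letter in the word can be brought together by commutations. -/
def CombReduced : List V → Prop
  | [] => True
  | s :: w => ¬ Leads G s w ∧ CombReduced w

variable {G}

theorem CombReduced.of_append {u w : List V} (h : CombReduced G (u ++ w)) : CombReduced G w := by
  induction u with
  | nil => exact h
  | cons a u ih => exact ih h.2

theorem leads_cons_of_adj {s c : V} (h : G.Adj s c) (w : List V) :
    Leads G s (c :: w) ↔ Leads G s w := by
  constructor
  · rintro (rfl | h')
    · exact absurd h (G.irrefl)
    · exact h'.2
  · exact fun h' => Or.inr ⟨h, h'⟩

open Classical in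
variable (G) in
/-- The projections of a word to the pairs of non-commuting letters; they determine the word up
to commutations. -/
noncomputable def pairProj (w : List V) (a b : V) : List V :=
  if G.Adj a b then [] else w.filter fun c => c = a ∨ c = b

theorem pairProj_cons_of_mem {a b c : V} (h : ¬ G.Adj a b) (hc : c = a ∨ c = b) (w : List V) :
    pairProj G (c :: w) a b = c :: pairProj G w a b := by
  simp [pairProj, h, hc]

theorem pairProj_cons_of_notMem {a b c : V} (hc : ¬ (c = a ∨ c = b)) (w : List V) :
    pairProj G (c :: w) a b = pairProj G w a b := by
  simp only [pairProj]
  rw [List.filter_cons_of_neg (by simpa using hc)]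

theorem pairProj_of_adj {a b : V} (h : G.Adj a b) (w : List V) : pairProj G w a b = [] := by
  simp [pairProj, h]

theorem pairProj_cons_inj {s : V} {u v : List V} :
    pairProj G (s :: u) = pairProj G (s :: v) ↔ pairProj G u = pairProj G v := by
  simp only [funext_iff]
  refine forall₂_congr fun a b => ?_
  by_cases h : G.Adj a b
  · simp [pairProj_of_adj h]
  by_cases hc : s = a ∨ s = b
  · simp [pairProj_cons_of_mem h hc]
  · simp [pairProj_cons_of_notMem hc]

theorem pairProj_cons_comm {s t : V} (h : G.Adj s t) (w : List V) :
    pairProj G (s :: t :: w) = pairProj G (t :: s :: w) := by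
  funext a b
  by_cases hab : G.Adj a b
  · simp [pairProj_of_adj hab]
  by_cases hs : s = a ∨ s = b <;> by_cases ht : t = a ∨ t = b
  · exfalso
    have := h.symm
    have := h.ne
    rcases hs with rfl | rfl <;> rcases ht with rfl | rfl <;> simp_all
  · simp [pairProj_cons_of_mem hab hs, pairProj_cons_of_notMem ht]
  · simp [pairProj_cons_of_mem hab ht, pairProj_cons_of_notMem hs]
  · simp [pairProj_cons_of_notMem hs, pairProj_cons_of_notMem ht]

/-- A letter can reach the front iff no non-commuting letter precedes it. The case `b = s` ensures
that `s` occurs at all. Being read off from the projections, leading is a property of the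
commutation class. -/
theorem leads_iff_pairProj (s : V) (w : List V) :
    Leads G s w ↔ ∀ b, ¬ G.Adj s b → (pairProj G w s b).head? = some s := by
  induction w with
  | nil =>
    simp only [Leads, false_iff, not_forall]
    exact ⟨s, G.irrefl, by simp [pairProj]⟩
  | cons c w ih =>
    by_cases hc : s = c
    · subst hc
      simp only [Leads, true_or, true_iff]
      intro b hb
      simp [pairProj_cons_of_mem hb]
    by_cases hadj : G.Adj s c
    · rw [leads_cons_of_adj hadj, ih]
      refine forall₂_congr fun b hb => ?_
      rw [pairProj_cons_of_notMem]
      rintro (rfl | rfl)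
      · exact hc rfl
      · exact hb hadj
    · simp only [Leads, hc, hadj, false_and, or_self, false_iff, not_forall]
      refine ⟨c, hadj, ?_⟩
      rw [pairProj_cons_of_mem hadj (Or.inr rfl)]
      simp [Ne.symm hc]

theorem leads_congr {w w' : List V} (h : pairProj G w = pairProj G w') (s : V) :
    Leads G s w ↔ Leads G s w' := by
  rw [leads_iff_pairProj, leads_iff_pairProj, h]

open Classical in
theorem pairProj_cons_erase {s : V} {w : List V} (h : Leads G s w) :
    pairProj G (s :: w.erase s) = pairProj G w := by
  induction w with
  | nil => exact h.elim
  | cons c w ih =>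
    by_cases hc : c = s
    · subst hc
      simp
    · rcases h with h | ⟨h, h'⟩
      · exact absurd h.symm hc
      · rw [List.erase_cons_tail (by simpa using hc), pairProj_cons_comm h, pairProj_cons_inj,
            ih h']

open Classical in
theorem leads_erase_iff {s t : V} {w : List V} (hst : G.Adj s t) (h : Leads G t w) :
    Leads G s (w.erase t) ↔ Leads G s w := by
  rw [← leads_cons_of_adj hst, leads_congr (pairProj_cons_erase h)]

-- A second leading `s` after erasing the first would be an `s` that the first could meet; letters
-- passed over commute with `s`, so erasing does not affect whether they lead.
open Classical in
theorem CombReduced.erase {s : V} {w : List V} (hw : CombReduced G w) (h : Leads G s w) :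
    CombReduced G (w.erase s) ∧ ¬ Leads G s (w.erase s) := by
  induction w with
  | nil => exact h.elim
  | cons c w ih =>
    by_cases hc : c = s
    · subst hc
      simpa using hw.symm
    · rcases h with h | ⟨h, h'⟩
      · exact absurd h.symm hc
      · rw [List.erase_cons_tail (by simpa using hc), leads_cons_of_adj h]
        obtain ⟨h1, h2⟩ := ih hw.2 h'
        exact ⟨⟨fun h3 => hw.1 ((leads_erase_iff h.symm h').1 h3), h1⟩, h2⟩

open Classical in
variable (G) in
/-- Left multiplication by a generator, on reduced words. -/
noncomputable def genStep (s : V) (w : List V) : List V :=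
  if Leads G s w then w.erase s else s :: w

theorem CombReduced.genStep {w : List V} (hw : CombReduced G w) (s : V) :
    CombReduced G (genStep G s w) := by
  classical
  unfold _root_.genStep
  split_ifs with h
  · exact (hw.erase h).1
  · exact ⟨h, hw⟩

theorem length_genStep_le (s : V) (w : List V) : (genStep G s w).length ≤ w.length + 1 := by
  classical
  unfold genStep
  split_ifs with h
  · exact (List.length_erase_le).trans (Nat.le_succ _)
  · simp

theorem pairProj_genStep_congr {w w' : List V} (h : pairProj G w = pairProj G w') (s : V) :
    pairProj G (genStep G s w) = pairProj G (genStep G s w') := by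
  unfold genStep
  by_cases hs : Leads G s w
  · have hs' := (leads_congr h s).1 hs
    rw [if_pos hs, if_pos hs', ← pairProj_cons_inj (s := s), pairProj_cons_erase hs,
      pairProj_cons_erase hs', h]
  · rw [if_neg hs, if_neg fun h' => hs ((leads_congr h s).2 h'), pairProj_cons_inj, h]

/-- Erasing and reinserting moves `s` to the front, so the generator is an involution only up to
commutation; this is why the action lives on the quotient. -/
theorem pairProj_genStep_genStep {w : List V} (hw : CombReduced G w) (s : V) :
    pairProj G (genStep G s (genStep G s w)) = pairProj G w := by
  classical
  by_cases hs : Leads G s w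
  · rw [genStep, genStep, if_pos hs, if_neg (hw.erase hs).2, pairProj_cons_erase hs]
  · have h : Leads G s (s :: w) := Or.inl rfl
    rw [genStep, genStep, if_neg hs, if_pos h, List.erase_cons_head]

theorem pairProj_genStep_comm {s t : V} (h : G.Adj s t) (w : List V) :
    pairProj G (genStep G s (genStep G t w)) = pairProj G (genStep G t (genStep G s w)) := by
  have hne := h.ne
  have hne' := h.ne'
  by_cases hs : Leads G s w <;> by_cases ht : Leads G t w
  · simp [genStep, hs, ht, leads_erase_iff h ht, leads_erase_iff h.symm hs, List.erase_comm]
  · simp [genStep, hs, ht, leads_cons_of_adj h, leads_erase_iff h.symm hs, hne']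
  · simp [genStep, hs, ht, leads_cons_of_adj h.symm, leads_erase_iff h ht, hne]
  · simp [genStep, hs, ht, leads_cons_of_adj h.symm, leads_cons_of_adj h, pairProj_cons_comm h]

theorem length_eq_of_pairProj_eq {w w' : List V} (h : pairProj G w = pairProj G w') :
    w.length = w'.length := by
  classical
  refine (List.perm_iff_count.2 fun a => ?_).length_eq
  -- The diagonal projection lists the occurrences of `a`, since `a` is not adjacent to itself.
  have := congrArg List.length (congrFun₂ h a a)
  simp only [pairProj, G.irrefl, if_false, or_self] at this
  simpa [List.count_eq_countP, List.countP_eq_length_filter, beq_eq_decide] using this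

variable (G) in
/-- Reduced words up to commutations. -/
noncomputable def reducedSetoid : Setoid {w : List V // CombReduced G w} :=
  Setoid.ker fun w => pairProj G w.1

variable (G) in
/-- The action of a generator on reduced words up to commutations. -/
noncomputable def genAction (s : V) : Function.End (Quotient (reducedSetoid G)) :=
  Quotient.map (fun w => ⟨genStep G s w.1, w.2.genStep s⟩)
    fun _ _ h => pairProj_genStep_congr h s

theorem genAction_mul_self (s : V) : genAction G s * genAction G s = 1 := by
  funext q
  induction q using Quotient.inductionOn with
  | h w => exact Quotient.sound (pairProj_genStep_genStep w.2 s)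

theorem genAction_comm {s t : V} (h : G.Adj s t) :
    genAction G s * genAction G t = genAction G t * genAction G s := by
  funext q
  induction q using Quotient.inductionOn with
  | h w => exact Quotient.sound (pairProj_genStep_comm h w.1)

theorem genAction_isLiftable : (racgMatrix G).IsLiftable (genAction G) := by
  intro s t
  by_cases hst : s = t
  · subst hst
    simp [genAction_mul_self]
  by_cases h : G.Adj s t
  · have : (racgMatrix G).M s t = 2 := by simp [racgMatrix, hst, h]
    rw [this, pow_two]
    nth_rw 1 [genAction_comm h]
    rw [mul_assoc, ← mul_assoc (genAction G s), genAction_mul_self, one_mul, genAction_mul_self]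
  · have : (racgMatrix G).M s t = 0 := by simp [racgMatrix, hst, h]
    rw [this, pow_zero]

variable (G) in
/-- The action of the right-angled Coxeter group on reduced words up to commutations. -/
noncomputable def racgAction : RACG G →* Function.End (Quotient (reducedSetoid G)) :=
  (racgSystem G).lift ⟨genAction G, genAction_isLiftable⟩

theorem racgAction_simple (s : V) : racgAction G ((racgSystem G).simple s) = genAction G s :=
  (racgSystem G).lift_apply_simple genAction_isLiftable s

theorem racgAction_one (q : Quotient (reducedSetoid G)) : racgAction G 1 q = q := by
  rw [map_one]
  rfl

theorem racgAction_wordProd_cons (s : V) (w : List V) (q : Quotient (reducedSetoid G)) :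
    racgAction G ((racgSystem G).wordProd (s :: w)) q =
      genAction G s (racgAction G ((racgSystem G).wordProd w) q) := by
  rw [(racgSystem G).wordProd_cons, map_mul, racgAction_simple]
  rfl

theorem racgAction_wordProd_of_combReduced {w : List V} (hw : CombReduced G w) :
    racgAction G ((racgSystem G).wordProd w) (Quotient.mk _ ⟨[], trivial⟩) =
      Quotient.mk _ ⟨w, hw⟩ := by
  induction w with
  | nil => rw [CoxeterSystem.wordProd_nil, racgAction_one]
  | cons s w ih =>
    rw [racgAction_wordProd_cons, ih hw.2]
    refine congrArg (Quotient.mk _) (Subtype.ext ?_)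
    exact if_neg hw.1

theorem exists_racgAction_wordProd (v : List V) :
    ∃ u : {w : List V // CombReduced G w}, u.1.length ≤ v.length ∧
      racgAction G ((racgSystem G).wordProd v) (Quotient.mk _ ⟨[], trivial⟩) =
        Quotient.mk _ u := by
  induction v with
  | nil => exact ⟨⟨[], trivial⟩, le_rfl, by rw [CoxeterSystem.wordProd_nil, racgAction_one]⟩
  | cons s v ih =>
    obtain ⟨u, hu, h⟩ := ih
    refine ⟨⟨genStep G s u.1, u.2.genStep s⟩, (length_genStep_le s u.1).trans ?_, ?_⟩
    · simpa using hu
    · rw [racgAction_wordProd_cons, h]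
      rfl

/-- A shortest word for the same element sends the empty word to the class of `w`, and each letter
lengthens a representative by at most one. -/
theorem CombReduced.isGeodesicWord {w : List V} (hw : CombReduced G w) : IsGeodesicWord G w := by
  refine le_antisymm ((racgSystem G).length_wordProd_le w) ?_
  obtain ⟨v, hv, hvw⟩ := (racgSystem G).exists_isReduced ((racgSystem G).wordProd w)
  obtain ⟨u, hu, h⟩ := exists_racgAction_wordProd (G := G) v
  rw [← hvw, racgAction_wordProd_of_combReduced hw] at h
  have h' : pairProj G w = pairProj G u.1 := Quotient.exact h
  rw [length_eq_of_pairProj_eq h', hvw, hv.eq]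
  exact hu

theorem racg_simple_comm {s t : V} (h : G.Adj s t) :
    (racgSystem G).simple s * (racgSystem G).simple t =
      (racgSystem G).simple t * (racgSystem G).simple s := by
  have h2 := (racgSystem G).simple_mul_simple_pow s t
  have : (racgMatrix G).M s t = 2 := by simp [racgMatrix, h.ne, h]
  rw [this, pow_two, mul_eq_one_iff_eq_inv, mul_inv_rev] at h2
  simpa using h2

open Classical in
theorem wordProd_eq_of_leads {s : V} {w : List V} (h : Leads G s w) :
    (racgSystem G).wordProd w =
      (racgSystem G).simple s * (racgSystem G).wordProd (w.erase s) := by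
  induction w with
  | nil => exact h.elim
  | cons c w ih =>
    by_cases hc : c = s
    · subst hc
      simp [CoxeterSystem.wordProd_cons]
    · rcases h with h | ⟨h, h'⟩
      · exact absurd h.symm hc
      · rw [List.erase_cons_tail (by simpa using hc), CoxeterSystem.wordProd_cons,
          CoxeterSystem.wordProd_cons, ih h', ← mul_assoc, ← mul_assoc, racg_simple_comm h]

theorem isGeodesicWord_iff {w : List V} : IsGeodesicWord G w ↔ CombReduced G w := by
  classical
  refine ⟨fun h => ?_, CombReduced.isGeodesicWord⟩
  induction w with
  | nil => trivial
  | cons s w ih =>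
    refine ⟨fun hs => ?_, ih ?_⟩
    -- If `s` led `w`, the two copies of `s` would cancel and leave a shorter word for the same
    -- element.
    · have h1 : (racgSystem G).length ((racgSystem G).wordProd (s :: w)) = w.length + 1 := h
      rw [CoxeterSystem.wordProd_cons, wordProd_eq_of_leads hs,
        CoxeterSystem.simple_mul_simple_cancel_left] at h1
      have h2 := (racgSystem G).length_wordProd_le (w.erase s)
      have h3 := List.length_erase_le (a := s) (l := w)
      omega
    · exact CoxeterSystem.IsReduced.drop (cs := racgSystem G) (ω := s :: w) h 1

end Words

/-! ### Counting reduced words by their leading letters -/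

section Counting

open Classical Finset

variable {V : Type*} [Fintype V] (G : SimpleGraph V)

/-- The letters that can be moved to the front of a word. -/
noncomputable def leadSet (w : List V) : Finset V := {s | Leads G s w}

/-- The number of ways to extend a reduced word with a given set of leading letters by `m` letters
on the left, so that it stays reduced. -/
noncomputable def extCount : ℕ → Finset V → ℕ
  | 0, _ => 1
  | m + 1, F => ∑ c ∈ Fᶜ, extCount m (insert c {a ∈ F | G.Adj c a})

/-- The reduced extensions of a word by `m` letters on the left. -/
def extSet (m : ℕ) (w : List V) : Set (List V) := {u | u.length = m ∧ CombReduced G (u ++ w)}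

variable {G}

theorem leadSet_nil : leadSet G ([] : List V) = ∅ :=
  Finset.eq_empty_of_forall_notMem fun _ h => (mem_filter.1 h).2

theorem leadSet_cons (c : V) (w : List V) :
    leadSet G (c :: w) = insert c {a ∈ leadSet G w | G.Adj c a} := by
  ext a
  simp [leadSet, Leads, G.adj_comm, and_comm]

theorem extSet_finite (m : ℕ) (w : List V) : (extSet G m w).Finite :=
  (List.finite_length_eq V m).subset fun _ h => h.1

/-- A reduced extension is given by its last letter and the letters before it. -/
noncomputable def extSetSuccEquiv (m : ℕ) (w : List V) :
    (Σ c : {c // c ∈ (leadSet G w)ᶜ}, extSet G m (c.1 :: w)) ≃ extSet G (m + 1) w :=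
  Equiv.ofBijective
    (fun x => ⟨x.2.1 ++ [x.1.1], by simp [x.2.2.1], by simpa using x.2.2.2⟩) <| by
    constructor
    · rintro ⟨⟨c, hc⟩, ⟨u, hu⟩⟩ ⟨⟨c', hc'⟩, ⟨u', hu'⟩⟩ h
      have h1 : u ++ [c] = u' ++ [c'] := congrArg Subtype.val h
      obtain ⟨rfl, h2⟩ := List.append_inj' h1 rfl
      obtain rfl : c = c' := by simpa using h2
      rfl
    · rintro ⟨u, hu, hr⟩
      obtain ⟨u', c, rfl⟩ : ∃ u' c, u = u' ++ [c] := by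
        rcases List.eq_nil_or_concat u with rfl | ⟨u', c, rfl⟩
        · simp at hu
        · exact ⟨u', c, by simp⟩
      have hr' : CombReduced G (u' ++ c :: w) := by simpa using hr
      refine ⟨⟨⟨c, ?_⟩, ⟨u', ?_, hr'⟩⟩, rfl⟩
      · simpa [leadSet] using hr'.of_append.1
      · simpa using hu

theorem ncard_extSet (m : ℕ) (w : List V) (hw : CombReduced G w) :
    (extSet G m w).ncard = extCount G m (leadSet G w) := by
  induction m generalizing w with
  | zero =>
    have : extSet G 0 w = {[]} := by
      ext u
      simp only [extSet, List.length_eq_zero_iff, Set.mem_ofPred_eq, Set.mem_singleton_iff,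
        and_iff_left_iff_imp]
      rintro rfl
      exact hw
    rw [this, Set.ncard_singleton, extCount]
  | succ m ih =>
    have := fun c => (extSet_finite (G := G) m (c :: w)).to_subtype
    rw [← Nat.card_coe_set_eq, ← Nat.card_congr (extSetSuccEquiv m w), Nat.card_sigma, extCount,
      ← Finset.sum_coe_sort (leadSet G w)ᶜ fun c =>
        extCount G m (insert c {a ∈ leadSet G w | G.Adj c a})]
    refine Finset.sum_congr rfl fun c _ => ?_
    rw [Nat.card_coe_set_eq, ih (c.1 :: w) ⟨by simpa [leadSet] using c.2, hw⟩, leadSet_cons]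

theorem geodesicGrowth_eq_extCount (m : ℕ) : geodesicGrowth G m = extCount G m ∅ := by
  rw [← leadSet_nil (G := G), ← ncard_extSet m [] trivial]
  simp [geodesicGrowth, extSet, isGeodesicWord_iff]

theorem geodesicGrowth_succ (m : ℕ) : geodesicGrowth G (m + 1) = ∑ v, extCount G m {v} := by
  rw [geodesicGrowth_eq_extCount, extCount]
  simp

/-- Prepending `c` leaves the leading set `{c}`, or `{v, c}` when `c` commutes with `v`; the last
sum corrects for the latter. -/
theorem extCount_singleton_succ (m : ℕ) (v : V) :
    (extCount G (m + 1) {v} : ℤ) = ∑ c, (extCount G m {c} : ℤ) - extCount G m {v} -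
      ∑ c, if G.Adj v c then (extCount G m {c} - extCount G m {v, c} : ℤ) else 0 := by
  have key : (extCount G (m + 1) {v} : ℤ) = ∑ c ∈ ({v} : Finset V)ᶜ, ((extCount G m {c} : ℤ) -
      if G.Adj v c then (extCount G m {c} - extCount G m {v, c} : ℤ) else 0) := by
    rw [extCount, Nat.cast_sum]
    refine Finset.sum_congr rfl fun c _ => ?_
    by_cases h : G.Adj v c
    · simp [h, h.symm, filter_singleton, pair_comm]
    · simp [h, G.adj_comm, filter_singleton]
  have split := Finset.sum_add_sum_compl {v} fun c => (extCount G m {c} : ℤ) -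
      if G.Adj v c then (extCount G m {c} - extCount G m {v, c} : ℤ) else 0
  rw [← key, Finset.sum_singleton, Finset.sum_sub_distrib, if_neg G.irrefl] at split
  linear_combination split

/-- Without triangles a new letter commutes with at most one of `a`, `b`, so no larger leading sets
arise. The neighbour sums are those of the singleton recursions at `a` and `b`, and are eliminated
with them. -/
theorem extCount_pair_succ (htri : ∀ a b c, G.Adj a b → G.Adj a c → ¬ G.Adj b c) (m : ℕ) {a b : V}
    (hab : G.Adj a b) :
    (extCount G (m + 1) {a, b} : ℤ) = extCount G (m + 1) {a} + extCount G (m + 1) {b} +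
      extCount G m {a} + extCount G m {b} - 2 * extCount G m {a, b} -
      ∑ c, (extCount G m {c} : ℤ) := by
  have hne := hab.ne
  have key : (extCount G (m + 1) {a, b} : ℤ) = ∑ c ∈ ({a, b} : Finset V)ᶜ,
      ((extCount G m {c} : ℤ) -
        (if G.Adj a c then (extCount G m {c} - extCount G m {a, c} : ℤ) else 0) -
        (if G.Adj b c then (extCount G m {c} - extCount G m {b, c} : ℤ) else 0)) := by
    rw [extCount, Nat.cast_sum]
    refine Finset.sum_congr rfl fun c hc => ?_
    by_cases ha : G.Adj a c
    · have hb : ¬ G.Adj b c := htri a b c hab ha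
      have : ({x ∈ ({a, b} : Finset V) | G.Adj c x}) = {a} := by
        ext x
        simp only [mem_filter, mem_insert, mem_singleton]
        constructor
        · rintro ⟨rfl | rfl, h⟩
          · rfl
          · exact absurd h.symm hb
        · rintro rfl
          exact ⟨Or.inl rfl, ha.symm⟩
      rw [this]
      simp [ha, hb, pair_comm]
    by_cases hb : G.Adj b c
    · have : ({x ∈ ({a, b} : Finset V) | G.Adj c x}) = {b} := by
        ext x
        simp only [mem_filter, mem_insert, mem_singleton]
        constructor
        · rintro ⟨rfl | rfl, h⟩
          · exact absurd h.symm ha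
          · rfl
        · rintro rfl
          exact ⟨Or.inr rfl, hb.symm⟩
      rw [this]
      simp [ha, hb, pair_comm]
    · have : ({x ∈ ({a, b} : Finset V) | G.Adj c x}) = ∅ := by
        ext x
        simp only [mem_filter, mem_insert, mem_singleton, notMem_empty, iff_false]
        rintro ⟨rfl | rfl, h⟩
        · exact ha h.symm
        · exact hb h.symm
      simp [ha, hb, this]
  have split := Finset.sum_add_sum_compl {a, b} fun c => ((extCount G m {c} : ℤ) -
        (if G.Adj a c then (extCount G m {c} - extCount G m {a, c} : ℤ) else 0) -
        (if G.Adj b c then (extCount G m {c} - extCount G m {b, c} : ℤ) else 0))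
  rw [← key, Finset.sum_pair hne, Finset.sum_sub_distrib, Finset.sum_sub_distrib] at split
  simp only [hab, hab.symm, G.irrefl, if_true, if_false, pair_comm b a] at split
  rw [extCount_singleton_succ m a, extCount_singleton_succ m b]
  linear_combination split

end Counting

/-! ### The linear system behind the growth series -/

section Series

open Classical Finset PowerSeries

/-- The geodesic growth series without its constant term, divided by `X`. -/
noncomputable def growthTail {V : Type*} (G : SimpleGraph V) : ℤ⟦X⟧ :=
  PowerSeries.mk fun m => (geodesicGrowth G (m + 1) : ℤ)

theorem growthTail_congr {V W : Type*} {G : SimpleGraph V} {H : SimpleGraph W}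
    (h : geodesicGrowthSeries G = geodesicGrowthSeries H) : growthTail G = growthTail H := by
  ext m
  have := congrArg (coeff (m + 1)) h
  simpa [growthTail, geodesicGrowthSeries] using this

variable {V : Type*} [Fintype V] (G : SimpleGraph V)

/-- The operator `(1 + X)(1 + 2X) - X(1 + X) D + X² A` on functions on the vertices, where `A` is
the adjacency matrix and `D` the degree matrix. -/
noncomputable def growthOp (z : V → ℤ⟦X⟧) (v : V) : ℤ⟦X⟧ :=
  (1 + X) * (1 + 2 * X) * z v + ∑ u, if G.Adj v u then X ^ 2 * z u - X * (1 + X) * z v else 0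

/-- The generating series of the reduced extensions of a word with given leading letters. -/
noncomputable def extSeries (F : Finset V) : ℤ⟦X⟧ := PowerSeries.mk fun m => (extCount G m F : ℤ)

variable {G}

theorem growthTail_eq_sum : growthTail G = ∑ v, extSeries G {v} := by
  ext m
  simp [growthTail, extSeries, geodesicGrowth_succ, map_sum]

theorem extSeries_singleton (v : V) :
    extSeries G {v} = 1 + X * (growthTail G - extSeries G {v} -
      ∑ c, if G.Adj v c then extSeries G {c} - extSeries G {v, c} else 0) := by
  ext m
  cases m with
  | zero => simp [extSeries, extCount]
  | succ m =>
    simp only [map_add, coeff_succ_X_mul, map_sub, map_sum, growthTail_eq_sum, coeff_one]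
    simp only [extSeries, coeff_mk, extCount_singleton_succ, apply_ite (coeff m), map_zero, map_sub]
    simp

theorem extSeries_pair (htri : ∀ a b c, G.Adj a b → G.Adj a c → ¬ G.Adj b c) {a b : V}
    (hab : G.Adj a b) :
    (1 + 2 * X) * extSeries G {a, b} =
      (1 + X) * (extSeries G {a} + extSeries G {b}) - 1 - X * growthTail G := by
  have : extSeries G {a, b} = extSeries G {a} + extSeries G {b} - 1 +
      X * (extSeries G {a} + extSeries G {b} - 2 * extSeries G {a, b} - growthTail G) := by
    ext m
    cases m with
    | zero => simp [extSeries, extCount]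
    | succ m =>
      rw [two_mul]
      simp only [map_add, coeff_succ_X_mul, map_sub, map_sum, growthTail_eq_sum, coeff_one]
      simp only [extSeries, coeff_mk, extCount_pair_succ htri m hab]
      simp
      ring
  linear_combination this

/-- Substituting `extSeries_pair` into `extSeries_singleton`, after multiplication by `1 + 2 * X`,
removes the edge series. Subtracting from the full series `1 + X * growthTail G` makes the
right-hand side the same at every vertex. -/
theorem growthOp_sub_extSeries (htri : ∀ a b c, G.Adj a b → G.Adj a c → ¬ G.Adj b c) (v : V) :
    growthOp G (fun u => 1 + X * growthTail G - extSeries G {u}) v =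
      X * (1 + 2 * X) * (1 + X * growthTail G) := by
  have h := extSeries_singleton (G := G) v
  have hs : (∑ u, if G.Adj v u then X ^ 2 * (1 + X * growthTail G - extSeries G {u}) -
        X * (1 + X) * (1 + X * growthTail G - extSeries G {v}) else 0) =
      -X * (1 + 2 * X) * ∑ c, if G.Adj v c then extSeries G {c} - extSeries G {v, c} else 0 := by
    rw [Finset.mul_sum]
    refine Finset.sum_congr rfl fun c _ => ?_
    split_ifs with hc
    · linear_combination (-X) * extSeries_pair htri hc
    · simp
  rw [growthOp, hs]
  linear_combination (-(1 + 2 * X)) * h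

/-- For a triangle-free graph the geodesic growth series is determined by the sum of the entries
of the inverse of `growthOp`. -/
theorem exists_growthOp_eq_one (htri : ∀ a b c, G.Adj a b → G.Adj a c → ¬ G.Adj b c) :
    ∃ z : V → ℤ⟦X⟧, (∀ v, growthOp G z v = 1) ∧
      X * (1 + 2 * X) * (1 + X * growthTail G) * ∑ v, z v =
        (Fintype.card V : ℤ⟦X⟧) * (1 + X * growthTail G) - growthTail G := by
  have hunit : IsUnit ((1 + 2 * X) * (1 + X * growthTail G) : ℤ⟦X⟧) := by
    rw [PowerSeries.isUnit_iff_constantCoeff]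
    simp
  -- Both series start with 1. With the unit `hunit`, this lets the right-hand side of the system be
  -- normalised to 1.
  have hX : ∀ v, X ∣ 1 + X * growthTail G - extSeries G {v} := by
    intro v
    rw [PowerSeries.X_dvd_iff]
    simp [extSeries, extCount]
  choose y hy using hX
  obtain ⟨k, hk⟩ := hunit.exists_right_inv
  have hz : ∀ v, 1 + X * growthTail G - extSeries G {v} =
      X * (1 + 2 * X) * (1 + X * growthTail G) * (k * y v) := by
    intro v
    rw [hy]
    linear_combination (-X * y v) * hk
  refine ⟨fun v => k * y v, fun v => ?_, ?_⟩
  · have h := growthOp_sub_extSeries htri v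
    simp only [hz] at h
    have hne : X * (1 + 2 * X) * (1 + X * growthTail G) ≠ (0 : ℤ⟦X⟧) := by
      rw [mul_assoc]
      exact mul_ne_zero X_ne_zero hunit.ne_zero
    refine mul_left_cancel₀ hne (Eq.trans ?_ (h.trans (mul_one _).symm))
    simp only [growthOp, mul_add, Finset.mul_sum, mul_ite, mul_zero]
    congr 1
    · ring
    · refine Finset.sum_congr rfl fun c _ => ?_
      split_ifs
      · ring
      · rfl
  · rw [Finset.mul_sum, ← Finset.sum_congr rfl fun v _ => hz v, Finset.sum_sub_distrib,
      ← growthTail_eq_sum]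
    simp [mul_add]

/-- For triangle-free graphs with equally many vertices, equal geodesic growth series have equal
sums of the solutions of `growthOp G z = 1`. -/
theorem sum_eq_of_geodesicGrowthSeries_eq {W : Type*} [Fintype W] {H : SimpleGraph W}
    (hG : ∀ a b c, G.Adj a b → G.Adj a c → ¬ G.Adj b c)
    (hH : ∀ a b c, H.Adj a b → H.Adj a c → ¬ H.Adj b c)
    (hcard : Fintype.card V = Fintype.card W)
    (h : geodesicGrowthSeries G = geodesicGrowthSeries H) :
    ∃ (z : V → ℤ⟦X⟧) (y : W → ℤ⟦X⟧), (∀ v, growthOp G z v = 1) ∧ (∀ v, growthOp H y v = 1) ∧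
      ∑ v, z v = ∑ w, y w := by
  obtain ⟨z, hz, hz'⟩ := exists_growthOp_eq_one hG
  obtain ⟨y, hy, hy'⟩ := exists_growthOp_eq_one hH
  refine ⟨z, y, hz, hy, ?_⟩
  rw [← growthTail_congr h, ← hcard, ← hz'] at hy'
  have hunit : IsUnit ((1 + 2 * X) * (1 + X * growthTail G) : ℤ⟦X⟧) := by
    rw [PowerSeries.isUnit_iff_constantCoeff]
    simp
  have hne : X * (1 + 2 * X) * (1 + X * growthTail G) ≠ (0 : ℤ⟦X⟧) := by
    rw [mul_assoc]
    exact mul_ne_zero X_ne_zero hunit.ne_zero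
  exact (mul_left_cancel₀ hne hy').symm

end Series

/-! ### Solving the system `X`-adically; symmetry of the operator -/

section GrowthOp

open Classical Finset PowerSeries

variable {V : Type*} [Fintype V] {G : SimpleGraph V}

/-- The operator is the identity modulo `X`, so solutions can be computed coefficient by
coefficient. -/
theorem growthOp_eq_add_X_mul (z : V → ℤ⟦X⟧) (v : V) :
    growthOp G z v = z v + X * ((3 + 2 * X) * z v +
      ∑ u, if G.Adj v u then X * z u - (1 + X) * z v else 0) := by
  have : (∑ u, if G.Adj v u then X ^ 2 * z u - X * (1 + X) * z v else 0) =
      X * ∑ u, if G.Adj v u then X * z u - (1 + X) * z v else 0 := by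
    rw [Finset.mul_sum]
    refine Finset.sum_congr rfl fun u _ => ?_
    split_ifs
    · ring
    · simp
  rw [growthOp, this]
  ring

theorem constantCoeff_of_growthOp_eq_one {z : V → ℤ⟦X⟧} (hz : ∀ v, growthOp G z v = 1) (v : V) :
    coeff 0 (z v) = 1 := by
  have := congrArg (coeff 0) (hz v)
  rw [growthOp_eq_add_X_mul] at this
  simpa using this

theorem coeff_one_of_growthOp_eq_one {z : V → ℤ⟦X⟧} (hz : ∀ v, growthOp G z v = 1) (v : V) :
    coeff 1 (z v) = (∑ u, if G.Adj v u then 1 else 0) - 3 := by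
  have h := congrArg (coeff (0 + 1)) (hz v)
  have h0 : constantCoeff (z v) = 1 := by simpa using constantCoeff_of_growthOp_eq_one hz v
  rw [growthOp_eq_add_X_mul, map_add, coeff_succ_X_mul, coeff_zero_eq_constantCoeff,
    map_add, map_sum] at h
  simp only [apply_ite constantCoeff, map_sub, map_mul, map_add, h0, constantCoeff_X, map_zero,
    map_one, map_ofNat, zero_mul, mul_zero, add_zero, mul_one, zero_sub, zero_add, coeff_one,
    one_ne_zero, if_false] at h
  have h2 : (∑ u, if G.Adj v u then (-1 : ℤ) else 0) = -∑ u, if G.Adj v u then 1 else 0 := by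
    rw [← Finset.sum_neg_distrib]
    exact Finset.sum_congr rfl fun u _ => by split_ifs <;> simp
  rw [h2] at h
  linear_combination h

theorem growthOp_sub (y z : V → ℤ⟦X⟧) (v : V) :
    growthOp G (y - z) v = growthOp G y v - growthOp G z v := by
  simp only [growthOp, Pi.sub_apply, mul_sub, add_sub_add_comm, ← Finset.sum_sub_distrib]
  congr 1
  refine Finset.sum_congr rfl fun u _ => ?_
  split_ifs
  · ring
  · simp

theorem growthOp_mul_left (c : ℤ⟦X⟧) (z : V → ℤ⟦X⟧) (v : V) :
    growthOp G (fun u => c * z u) v = c * growthOp G z v := by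
  simp only [growthOp, mul_add, Finset.mul_sum, mul_ite, mul_zero]
  congr 1
  · ring
  · refine Finset.sum_congr rfl fun u _ => ?_
    split_ifs
    · ring
    · rfl

/-- The adjacency matrix is symmetric and the remaining terms are diagonal. -/
theorem sum_mul_growthOp_comm (y z : V → ℤ⟦X⟧) :
    ∑ v, y v * growthOp G z v = ∑ v, z v * growthOp G y v := by
  simp only [growthOp, mul_add (y _), mul_add (z _), Finset.sum_add_distrib, Finset.mul_sum]
  congr 1
  · exact Finset.sum_congr rfl fun v _ => by ring
  · have : ∀ x w : V → ℤ⟦X⟧,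
        (∑ v, ∑ u, x v * (if G.Adj v u then X ^ 2 * w u - X * (1 + X) * w v else 0)) =
          (∑ v, ∑ u, if G.Adj v u then X ^ 2 * (x v * w u) else 0) -
            ∑ v, ∑ u, if G.Adj v u then X * (1 + X) * (x v * w v) else 0 := by
      intro x w
      simp only [← Finset.sum_sub_distrib]
      refine Finset.sum_congr rfl fun v _ => Finset.sum_congr rfl fun u _ => ?_
      split_ifs
      · ring
      · simp
    rw [this y z, this z y, Finset.sum_comm]
    simp only [G.adj_comm, mul_comm (z _) (y _)]

/-- Uniqueness modulo `X ^ N` of the solution with prescribed value at `s`: neighbours enter with a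
factor `X`, so each induction step gains one power. -/
theorem X_pow_dvd_of_growthOp {N : ℕ} {s : V} {z : V → ℤ⟦X⟧} (hs : X ^ N ∣ z s)
    (h : ∀ v, v ≠ s → X ^ N ∣ growthOp G z v) (v : V) : X ^ N ∣ z v := by
  suffices ∀ k ≤ N, ∀ v, X ^ k ∣ z v from this N le_rfl v
  intro k
  induction k with
  | zero => simp
  | succ k ih =>
    intro hk v
    have ih := ih (Nat.le_of_succ_le hk)
    by_cases hv : v = s
    · exact hv ▸ (pow_dvd_pow X hk).trans hs
    · have h1 := (pow_dvd_pow X hk).trans (h v hv)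
      rw [growthOp_eq_add_X_mul] at h1
      refine (dvd_add_left ?_).1 h1
      rw [pow_succ']
      refine mul_dvd_mul_left X (dvd_add ((ih v).mul_left _) (Finset.dvd_sum fun u _ => ?_))
      split_ifs
      · exact dvd_sub ((ih u).mul_left _) ((ih v).mul_left _)
      · exact dvd_zero _

end GrowthOp

/-! ### The system on a coalescence -/

section Coalescence

open Classical Finset PowerSeries

variable {V W : Type*} {τ : SimpleGraph V} {r : V} {H : SimpleGraph W} {s : W}

/-- The restriction of a function on a coalescence to the second graph. -/
noncomputable def coalescenceRight {R : Type*} (r : V) (s : W) (z : V ⊕ {w : W // w ≠ s} → R)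
    (w : W) : R :=
  if h : w = s then z (.inl r) else z (.inr ⟨w, h⟩)

theorem coalescenceRight_root {R : Type*} (z : V ⊕ {w : W // w ≠ s} → R) :
    coalescenceRight r s z s = z (.inl r) := by
  simp [coalescenceRight]

theorem coalescenceRight_of_ne {R : Type*} (z : V ⊕ {w : W // w ≠ s} → R) (w : {w : W // w ≠ s}) :
    coalescenceRight r s z w = z (.inr w) := by
  simp [coalescenceRight, w.2]

variable [Fintype V] [Fintype W] [DecidableEq W]

/-- The contribution of the edges at the root of the second graph of a coalescence. -/
noncomputable def rootTerm (H : SimpleGraph W) (s : W) (ζ : W → ℤ⟦X⟧) : ℤ⟦X⟧ :=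
  ∑ u, if H.Adj s u then X ^ 2 * ζ u - X * (1 + X) * ζ s else 0

theorem growthOp_coalescence_inr (z : V ⊕ {w : W // w ≠ s} → ℤ⟦X⟧) (w : {w : W // w ≠ s}) :
    growthOp (coalescence τ r H s) z (.inr w) = growthOp H (coalescenceRight r s z) w := by
  simp only [growthOp, Fintype.sum_sum_type, coalescence, coalescenceRight_of_ne]
  rw [Fintype.sum_eq_add_sum_subtype_ne _ s]
  simp only [coalescenceRight_root, coalescenceRight_of_ne]
  congr 2
  rw [Fintype.sum_eq_single r]
  · simp [H.adj_comm]
  · simp +contextual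

theorem growthOp_coalescence_inl (z : V ⊕ {w : W // w ≠ s} → ℤ⟦X⟧) (v : V) :
    growthOp (coalescence τ r H s) z (.inl v) = growthOp τ (fun v => z (.inl v)) v +
      if v = r then rootTerm H s (coalescenceRight r s z) else 0 := by
  simp only [growthOp, Fintype.sum_sum_type, coalescence, rootTerm]
  rw [add_assoc]
  congr 2
  by_cases hv : v = r
  · subst hv
    rw [if_pos rfl, Fintype.sum_eq_add_sum_subtype_ne _ s]
    simp [coalescenceRight_root, coalescenceRight_of_ne]
  · simp [hv]

theorem sum_coalescence (z : V ⊕ {w : W // w ≠ s} → ℤ⟦X⟧) :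
    ∑ x, z x = ∑ v, z (.inl v) + (∑ w, coalescenceRight r s z w - z (.inl r)) := by
  rw [Fintype.sum_sum_type, Fintype.sum_eq_add_sum_subtype_ne _ s]
  simp [coalescenceRight_root, coalescenceRight_of_ne]

/-- The sums over the common part of two coalescences differ by terms at the root. -/
theorem sum_inl_sub_sum_inl {H' : SimpleGraph W}
    {z y : V ⊕ {w : W // w ≠ s} → ℤ⟦X⟧}
    (hz : ∀ x, growthOp (coalescence τ r H s) z x = 1)
    (hy : ∀ x, growthOp (coalescence τ r H' s) y x = 1) :
    ∑ v, z (.inl v) - ∑ v, y (.inl v) =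
      z (.inl r) * rootTerm H' s (coalescenceRight r s y) -
        y (.inl r) * rootTerm H s (coalescenceRight r s z) := by
  -- Restricted to `τ`, both solutions have right-hand side 1 except for a correction at `r`.
  have h := sum_mul_growthOp_comm (G := τ) (fun v => z (.inl v)) (fun v => y (.inl v))
  have hz' : ∀ v, growthOp τ (fun v => z (.inl v)) v =
      1 - if v = r then rootTerm H s (coalescenceRight r s z) else 0 := fun v => by
    rw [← hz (.inl v), growthOp_coalescence_inl, add_sub_cancel_right]
  have hy' : ∀ v, growthOp τ (fun v => y (.inl v)) v =
      1 - if v = r then rootTerm H' s (coalescenceRight r s y) else 0 := fun v => by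
    rw [← hy (.inl v), growthOp_coalescence_inl, add_sub_cancel_right]
  simp only [hz', hy', mul_sub, mul_one, Finset.sum_sub_distrib, mul_ite, mul_zero,
    Finset.sum_ite_eq', Finset.mem_univ, if_true] at h
  linear_combination h

theorem sum_coalescence_adj_root :
    (∑ x, if (coalescence τ r H s).Adj (.inl r) x then (1 : ℤ) else 0) =
      (∑ v, if τ.Adj r v then 1 else 0) + ∑ w, if H.Adj s w then 1 else 0 := by
  rw [Fintype.sum_sum_type,
      Fintype.sum_eq_add_sum_subtype_ne (fun w => if H.Adj s w then _ else _) s]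
  simp only [coalescence, true_and, H.irrefl, if_false, zero_add]
  congr!

end Coalescence

/-! ### Truncated solutions on Godsil's trees -/

section Godsil

theorem godsilS₁_adj_iff (a b : Fin 11) : godsilS₁.Adj a b ↔
    b ∈ (![{1, 2}, {0, 3}, {0, 4, 5}, {1, 6}, {2}, {2, 10}, {3}, {8, 9, 10}, {7}, {7}, {5, 7}] :
      Fin 11 → Finset (Fin 11)) a := by
  simp only [godsilS₁, SimpleGraph.fromEdgeSet_adj, Set.mem_insert_iff, Set.mem_singleton_iff]
  revert a b
  decide

theorem godsilS₂_adj_iff (a b : Fin 11) : godsilS₂.Adj a b ↔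
    b ∈ (![{2, 10}, {3, 4, 10}, {0, 5, 6}, {1, 7}, {1}, {2}, {2}, {3, 8}, {7, 9}, {8}, {0, 1}] :
      Fin 11 → Finset (Fin 11)) a := by
  simp only [godsilS₂, SimpleGraph.fromEdgeSet_adj, Set.mem_insert_iff, Set.mem_singleton_iff]
  revert a b
  decide

open Classical Finset PowerSeries

theorem growthOp_godsilS₁ (z : Fin 11 → ℤ⟦X⟧) (v : Fin 11) :
    growthOp godsilS₁ z v = (1 + X) * (1 + 2 * X) * z v +
      ∑ u ∈ (![{1, 2}, {0, 3}, {0, 4, 5}, {1, 6}, {2}, {2, 10}, {3}, {8, 9, 10}, {7}, {7}, {5, 7}] :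
        Fin 11 → Finset (Fin 11)) v, (X ^ 2 * z u - X * (1 + X) * z v) := by
  simp only [growthOp, godsilS₁_adj_iff]
  rw [Finset.sum_ite_mem, Finset.univ_inter]

theorem growthOp_godsilS₂ (z : Fin 11 → ℤ⟦X⟧) (v : Fin 11) :
    growthOp godsilS₂ z v = (1 + X) * (1 + 2 * X) * z v +
      ∑ u ∈ (![{2, 10}, {3, 4, 10}, {0, 5, 6}, {1, 7}, {1}, {2}, {2}, {3, 8}, {7, 9}, {8}, {0, 1}] :
        Fin 11 → Finset (Fin 11)) v, (X ^ 2 * z u - X * (1 + X) * z v) := by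
  simp only [growthOp, godsilS₂_adj_iff]
  rw [Finset.sum_ite_mem, Finset.univ_inter]

/-- The solution of `growthOp z = 1` off the root with value `0` at the root, modulo `X ^ 8`. -/
noncomputable def godsilBase₁ : Fin 11 → ℤ⟦X⟧ :=
  ![0,
    1 - X + X ^ 3 - 4 * X ^ 5 + 10 * X ^ 6 - 16 * X ^ 7,
    1 - X ^ 2 + 3 * X ^ 3 - 2 * X ^ 4 + 3 * X ^ 5 - 5 * X ^ 6 + 15 * X ^ 7,
    1 - X - X ^ 2 + 4 * X ^ 3 - 6 * X ^ 4 + 6 * X ^ 5 - 7 * X ^ 6 + 16 * X ^ 7,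
    1 - 2 * X + 2 * X ^ 2 - 2 * X ^ 3 + 3 * X ^ 4 - 7 * X ^ 5 + 13 * X ^ 6 - 22 * X ^ 7,
    1 - X - X ^ 2 + 2 * X ^ 3 - 5 * X ^ 5 + 6 * X ^ 6 - X ^ 7,
    1 - 2 * X + 2 * X ^ 2 - X ^ 3 + X ^ 4 - 5 * X ^ 5 + 15 * X ^ 6 - 31 * X ^ 7,
    1 - 2 * X ^ 2 + 5 * X ^ 3 - 5 * X ^ 4 + 7 * X ^ 5 - 14 * X ^ 6 + 37 * X ^ 7,
    1 - 2 * X + 2 * X ^ 2 - 2 * X ^ 3 + 4 * X ^ 4 - 11 * X ^ 5 + 23 * X ^ 6 - 42 * X ^ 7,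
    1 - 2 * X + 2 * X ^ 2 - 2 * X ^ 3 + 4 * X ^ 4 - 11 * X ^ 5 + 23 * X ^ 6 - 42 * X ^ 7,
    1 - X - X ^ 2 + 2 * X ^ 3 + X ^ 4 - 8 * X ^ 5 + 13 * X ^ 6 - 15 * X ^ 7]

theorem growthOp_godsilBase₁ (w : Fin 11) (hw : w ≠ 0) :
    X ^ 8 ∣ growthOp godsilS₁ godsilBase₁ w - 1 := by
  -- The operator has degree 2 in `X`, so the truncation at degree 7 leaves a residue in degrees 8
  -- and 9 only. The entry at the excluded root is a dummy.
  refine ⟨(![0, -23 + 16 * X, 24 - 38 * X, 41 - 47 * X, -36 - 7 * X, 7, -54 - 15 * X,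
      73 - 136 * X, -75 - 5 * X, -75 - 5 * X, -23 + 36 * X] : Fin 11 → ℤ⟦X⟧) w, ?_⟩
  rw [growthOp_godsilS₁]
  fin_cases w
  · exact absurd rfl hw
  all_goals
    simp [godsilBase₁]
    try ring

/-- The solution of `growthOp z = 0` off the root with value `1` at the root, modulo `X ^ 8`. -/
noncomputable def godsilRoot₁ : Fin 11 → ℤ⟦X⟧ :=
  ![1,
    -X ^ 2 + X ^ 3 - X ^ 4 + X ^ 5 - 2 * X ^ 6 + 4 * X ^ 7,
    -X ^ 2 - X ^ 4 - 3 * X ^ 6 + 3 * X ^ 7,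
    X ^ 4 - 2 * X ^ 5 + 3 * X ^ 6 - 4 * X ^ 7,
    X ^ 4 - 2 * X ^ 5 + 4 * X ^ 6 - 6 * X ^ 7,
    X ^ 4 - X ^ 5 + 2 * X ^ 6 - 2 * X ^ 7,
    -X ^ 6 + 4 * X ^ 7,
    0,
    0,
    0,
    -X ^ 6 + 2 * X ^ 7]

theorem growthOp_godsilRoot₁ (w : Fin 11) (hw : w ≠ 0) :
    X ^ 8 ∣ growthOp godsilS₁ godsilRoot₁ w := by
  refine ⟨(![0, 7 - 4 * X, 9 - 11 * X, -7 + 8 * X, -11 - 3 * X, -6 + 5 * X, 10, -1 + 2 * X, 0, 0,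
      4 - 2 * X] : Fin 11 → ℤ⟦X⟧) w, ?_⟩
  rw [growthOp_godsilS₁]
  fin_cases w
  · exact absurd rfl hw
  all_goals
    simp [godsilRoot₁]
    try ring

/-- The solution of `growthOp z = 1` off the root with value `0` at the root, modulo `X ^ 8`. -/
noncomputable def godsilBase₂ : Fin 11 → ℤ⟦X⟧ :=
  ![0,
    1 - 2 * X ^ 2 + 4 * X ^ 3 - 3 * X ^ 4 + 4 * X ^ 5 - 10 * X ^ 6 + 28 * X ^ 7,
    1 - X ^ 2 + 4 * X ^ 3 - 5 * X ^ 4 + 8 * X ^ 5 - 11 * X ^ 6 + 24 * X ^ 7,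
    1 - X - X ^ 2 + 2 * X ^ 3 + X ^ 4 - 8 * X ^ 5 + 12 * X ^ 6 - 11 * X ^ 7,
    1 - 2 * X + 2 * X ^ 2 - 2 * X ^ 3 + 4 * X ^ 4 - 10 * X ^ 5 + 19 * X ^ 6 - 32 * X ^ 7,
    1 - 2 * X + 2 * X ^ 2 - 2 * X ^ 3 + 3 * X ^ 4 - 8 * X ^ 5 + 18 * X ^ 6 - 36 * X ^ 7,
    1 - 2 * X + 2 * X ^ 2 - 2 * X ^ 3 + 3 * X ^ 4 - 8 * X ^ 5 + 18 * X ^ 6 - 36 * X ^ 7,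
    1 - X - X ^ 2 + 3 * X ^ 3 - X ^ 4 - 5 * X ^ 5 + 9 * X ^ 6 - 4 * X ^ 7,
    1 - X - X ^ 2 + 4 * X ^ 3 - 5 * X ^ 4 + 3 * X ^ 5 - 3 * X ^ 6 + 13 * X ^ 7,
    1 - 2 * X + 2 * X ^ 2 - X ^ 3 + X ^ 4 - 5 * X ^ 5 + 14 * X ^ 6 - 26 * X ^ 7,
    1 - X + 2 * X ^ 4 - 6 * X ^ 5 + 9 * X ^ 6 - 13 * X ^ 7]

theorem growthOp_godsilBase₂ (w : Fin 11) (hw : w ≠ 0) :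
    X ^ 8 ∣ growthOp godsilS₂ godsilBase₂ w - 1 := by
  refine ⟨(![0, 50 - 84 * X, 47 - 96 * X, -12 + 24 * X, -55 - 4 * X, -65 - 12 * X, -65 - 12 * X,
      5 + 2 * X, 36 - 30 * X, -41 - 13 * X, -23 + 28 * X] : Fin 11 → ℤ⟦X⟧) w, ?_⟩
  rw [growthOp_godsilS₂]
  fin_cases w
  · exact absurd rfl hw
  all_goals
    simp [godsilBase₂]
    try ring

/-- The solution of `growthOp z = 0` off the root with value `1` at the root, modulo `X ^ 8`. -/
noncomputable def godsilRoot₂ : Fin 11 → ℤ⟦X⟧ :=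
  ![1,
    X ^ 4 - X ^ 5 + 2 * X ^ 6 - 2 * X ^ 7,
    -X ^ 2 - X ^ 4 - 3 * X ^ 6 + 4 * X ^ 7,
    -X ^ 6 + 2 * X ^ 7,
    -X ^ 6 + 3 * X ^ 7,
    X ^ 4 - 2 * X ^ 5 + 4 * X ^ 6 - 6 * X ^ 7,
    X ^ 4 - 2 * X ^ 5 + 4 * X ^ 6 - 6 * X ^ 7,
    0,
    0,
    0,
    -X ^ 2 + X ^ 3 - X ^ 4 + X ^ 5 - 2 * X ^ 6 + 3 * X ^ 7]

theorem growthOp_godsilRoot₂ (w : Fin 11) (hw : w ≠ 0) :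
    X ^ 8 ∣ growthOp godsilS₂ godsilRoot₂ w := by
  refine ⟨(![0, -6 + 10 * X, 11 - 16 * X, 4 - 2 * X, 7 + X, -11 - 2 * X, -11 - 2 * X, -1 + 2 * X,
      0, 0, 5 - 2 * X] : Fin 11 → ℤ⟦X⟧) w, ?_⟩
  rw [growthOp_godsilS₂]
  fin_cases w
  · exact absurd rfl hw
  all_goals
    simp [godsilRoot₂]
    try ring

end Godsil

/-! ### The growth series differ -/

section GrowthDiffers

open Classical Finset PowerSeries

variable {V : Type*} [Fintype V] {τ : SimpleGraph V} {r : V}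

/-- The difference vanishes at the root and is killed modulo `X ^ N` by the operator elsewhere, so
uniqueness applies. -/
theorem coalescenceRight_modEq {W : Type*} [Fintype W] [DecidableEq W] {H : SimpleGraph W} {s : W}
    {N : ℕ}
    {a b : W → ℤ⟦X⟧} (ha : ∀ w, w ≠ s → X ^ N ∣ growthOp H a w - 1)
    (hb : ∀ w, w ≠ s → X ^ N ∣ growthOp H b w) (ha0 : a s = 0) (hb0 : b s = 1)
    {z : V ⊕ {w : W // w ≠ s} → ℤ⟦X⟧} (hz : ∀ x, growthOp (coalescence τ r H s) z x = 1) (w : W) :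
    X ^ N ∣ coalescenceRight r s z w - (a w + z (.inl r) * b w) := by
  have key := X_pow_dvd_of_growthOp (G := H) (N := N) (s := s)
    (z := coalescenceRight r s z - a - fun w => z (.inl r) * b w) ?_ ?_ w
  · simpa [sub_sub] using key
  · simp [coalescenceRight_root, ha0, hb0]
  · intro v hv
    have h1 : growthOp H (coalescenceRight r s z) v = 1 := by
      rw [← hz (.inr ⟨v, hv⟩), growthOp_coalescence_inr]
    rw [growthOp_sub, growthOp_sub, growthOp_mul_left, h1]
    refine dvd_sub ?_ ((hb v hv).mul_left _)
    rw [← neg_sub, dvd_neg]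
    exact ha v hv

/-- By symmetry of the operator, the coefficient of the root value in the sum is, up to sign, the
constant part of the root term. The coefficient of the root value in the root term is the same for
both Godsil trees to this order. -/
theorem godsilS₁_coalescence_modEq {z : V ⊕ {w : Fin 11 // w ≠ 0} → ℤ⟦X⟧}
    (hz : ∀ x, growthOp (coalescence τ r godsilS₁ 0) z x = 1) :
    X ^ 8 ∣ ∑ w, coalescenceRight r 0 z w - z (.inl r) -
      ((10 - 12 * X + 2 * X ^ 2 + 10 * X ^ 3 - 35 * X ^ 5 + 77 * X ^ 6 - 101 * X ^ 7) -
        z (.inl r) * (2 * X ^ 2 - X ^ 3 - X ^ 4 + 4 * X ^ 5 - 2 * X ^ 6 - X ^ 7)) ∧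
    X ^ 8 ∣ rootTerm godsilS₁ 0 (coalescenceRight r 0 z) -
      ((2 * X ^ 2 - X ^ 3 - X ^ 4 + 4 * X ^ 5 - 2 * X ^ 6 - X ^ 7) -
        z (.inl r) * (2 * X + 2 * X ^ 2 + 2 * X ^ 4 - X ^ 5 + 2 * X ^ 6 - X ^ 7)) := by
  have ha0 : godsilBase₁ 0 = 0 := rfl
  have hb0 : godsilRoot₁ 0 = 1 := rfl
  have hdvd : ∀ w, X ^ 8 ∣ coalescenceRight r 0 z w - (godsilBase₁ w + z (.inl r) * godsilRoot₁ w)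
      :=
    fun w => coalescenceRight_modEq (H := godsilS₁) (a := godsilBase₁) (b := godsilRoot₁) (N := 8)
      growthOp_godsilBase₁ growthOp_godsilRoot₁ ha0 hb0 hz w
  choose e he using hdvd
  have he' : ∀ w, coalescenceRight r 0 z w =
      godsilBase₁ w + z (.inl r) * godsilRoot₁ w + X ^ 8 * e w := fun w => by
    rw [← he w]
    ring
  constructor
  · refine ⟨∑ w, e w, ?_⟩
    simp only [he', Finset.sum_add_distrib, ← Finset.mul_sum]
    have hb : ∑ w, godsilBase₁ w = 10 - 12 * X + 2 * X ^ 2 + 10 * X ^ 3 - 35 * X ^ 5 + 77 * X ^ 6 -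
        101 * X ^ 7 := by
      simp only [godsilBase₁, Fin.sum_univ_succ, Matrix.cons_val_zero, Matrix.cons_val_succ,
          Fin.sum_univ_zero]
      ring
    have hr : ∑ w, godsilRoot₁ w = 1 - (2 * X ^ 2 - X ^ 3 - X ^ 4 + 4 * X ^ 5 - 2 * X ^ 6 - X ^ 7)
        := by
      simp only [godsilRoot₁, Fin.sum_univ_succ, Matrix.cons_val_zero, Matrix.cons_val_succ,
          Fin.sum_univ_zero]
      ring
    rw [hb, hr]
    ring
  -- The factor `X ^ 2` pushes the top two coefficients of the truncations into degrees 8 and 9.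
  · refine ⟨5 - X + z (.inl r) * (-5 + 7 * X) + X ^ 2 * (e 1 + e 2), ?_⟩
    have h : rootTerm godsilS₁ 0 (coalescenceRight r 0 z) =
        X ^ 2 * (coalescenceRight r 0 z 1 + coalescenceRight r 0 z 2) -
          2 * (X * (1 + X) * z (.inl r)) := by
      have h0 : (![{1, 2}, {0, 3}, {0, 4, 5}, {1, 6}, {2}, {2, 10}, {3}, {8, 9, 10}, {7}, {7}, {5,
          7}] : Fin 11 → Finset (Fin 11)) 0 = {1, 2} := rfl
      simp only [rootTerm, godsilS₁_adj_iff]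
      rw [Finset.sum_ite_mem, Finset.univ_inter, h0, Finset.sum_pair (by decide),
        coalescenceRight_root]
      ring
    have hb1 : godsilBase₁ 1 = 1 - X + X ^ 3 - 4 * X ^ 5 + 10 * X ^ 6 - 16 * X ^ 7 := rfl
    have hb2 : godsilBase₁ 2 = 1 - X ^ 2 + 3 * X ^ 3 - 2 * X ^ 4 + 3 * X ^ 5 - 5 * X ^ 6 + 15 * X ^
        7 := rfl
    have hr1 : godsilRoot₁ 1 = -X ^ 2 + X ^ 3 - X ^ 4 + X ^ 5 - 2 * X ^ 6 + 4 * X ^ 7 := rfl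
    have hr2 : godsilRoot₁ 2 = -X ^ 2 - X ^ 4 - 3 * X ^ 6 + 3 * X ^ 7 := rfl
    rw [h, he', he', hb1, hb2, hr1, hr2]
    ring

theorem godsilS₂_coalescence_modEq {z : V ⊕ {w : Fin 11 // w ≠ 0} → ℤ⟦X⟧}
    (hz : ∀ x, growthOp (coalescence τ r godsilS₂ 0) z x = 1) :
    X ^ 8 ∣ ∑ w, coalescenceRight r 0 z w - z (.inl r) -
      ((10 - 12 * X + 2 * X ^ 2 + 10 * X ^ 3 - 35 * X ^ 5 + 75 * X ^ 6 - 93 * X ^ 7) -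
        z (.inl r) * (2 * X ^ 2 - X ^ 3 - X ^ 4 + 4 * X ^ 5 - 3 * X ^ 6 + 2 * X ^ 7)) ∧
    X ^ 8 ∣ rootTerm godsilS₂ 0 (coalescenceRight r 0 z) -
      ((2 * X ^ 2 - X ^ 3 - X ^ 4 + 4 * X ^ 5 - 3 * X ^ 6 + 2 * X ^ 7) -
        z (.inl r) * (2 * X + 2 * X ^ 2 + 2 * X ^ 4 - X ^ 5 + 2 * X ^ 6 - X ^ 7)) := by
  have ha0 : godsilBase₂ 0 = 0 := rfl
  have hb0 : godsilRoot₂ 0 = 1 := rfl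
  have hdvd : ∀ w, X ^ 8 ∣ coalescenceRight r 0 z w - (godsilBase₂ w + z (.inl r) * godsilRoot₂ w)
      :=
    fun w => coalescenceRight_modEq (H := godsilS₂) (a := godsilBase₂) (b := godsilRoot₂) (N := 8)
      growthOp_godsilBase₂ growthOp_godsilRoot₂ ha0 hb0 hz w
  choose e he using hdvd
  have he' : ∀ w, coalescenceRight r 0 z w =
      godsilBase₂ w + z (.inl r) * godsilRoot₂ w + X ^ 8 * e w := fun w => by
    rw [← he w]
    ring
  constructor
  · refine ⟨∑ w, e w, ?_⟩
    simp only [he', Finset.sum_add_distrib, ← Finset.mul_sum]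
    have hb : ∑ w, godsilBase₂ w = 10 - 12 * X + 2 * X ^ 2 + 10 * X ^ 3 - 35 * X ^ 5 + 75 * X ^ 6 -
        93 * X ^ 7 := by
      simp only [godsilBase₂, Fin.sum_univ_succ, Matrix.cons_val_zero, Matrix.cons_val_succ,
          Fin.sum_univ_zero]
      ring
    have hr : ∑ w, godsilRoot₂ w = 1 - (2 * X ^ 2 - X ^ 3 - X ^ 4 + 4 * X ^ 5 - 3 * X ^ 6 + 2 * X ^
        7) := by
      simp only [godsilRoot₂, Fin.sum_univ_succ, Matrix.cons_val_zero, Matrix.cons_val_succ,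
          Fin.sum_univ_zero]
      ring
    rw [hb, hr]
    ring
  · refine ⟨-2 + 11 * X + z (.inl r) * (-5 + 7 * X) + X ^ 2 * (e 2 + e 10), ?_⟩
    have h : rootTerm godsilS₂ 0 (coalescenceRight r 0 z) =
        X ^ 2 * (coalescenceRight r 0 z 2 + coalescenceRight r 0 z 10) -
          2 * (X * (1 + X) * z (.inl r)) := by
      have h0 : (![{2, 10}, {3, 4, 10}, {0, 5, 6}, {1, 7}, {1}, {2}, {2}, {3, 8}, {7, 9}, {8}, {0,
          1}] : Fin 11 → Finset (Fin 11)) 0 = {2, 10} := rfl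
      simp only [rootTerm, godsilS₂_adj_iff]
      rw [Finset.sum_ite_mem, Finset.univ_inter, h0, Finset.sum_pair (by decide),
        coalescenceRight_root]
      ring
    have hb1 : godsilBase₂ 2 = 1 - X ^ 2 + 4 * X ^ 3 - 5 * X ^ 4 + 8 * X ^ 5 - 11 * X ^ 6 + 24 * X
        ^ 7 := rfl
    have hb2 : godsilBase₂ 10 = 1 - X + 2 * X ^ 4 - 6 * X ^ 5 + 9 * X ^ 6 - 13 * X ^ 7 := rfl
    have hr1 : godsilRoot₂ 2 = -X ^ 2 - X ^ 4 - 3 * X ^ 6 + 4 * X ^ 7 := rfl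
    have hr2 : godsilRoot₂ 10 = -X ^ 2 + X ^ 3 - X ^ 4 + X ^ 5 - 2 * X ^ 6 + 3 * X ^ 7 := rfl
    rw [h, he', he', hb1, hb2, hr1, hr2]
    ring

theorem geodesicGrowthSeries_coalescence_ne (hr : ∃ v, τ.Adj r v)
    (h₁ : (coalescence τ r godsilS₁ 0).IsTree) (h₂ : (coalescence τ r godsilS₂ 0).IsTree) :
    geodesicGrowthSeries (coalescence τ r godsilS₁ 0) ≠
      geodesicGrowthSeries (coalescence τ r godsilS₂ 0) := by
  intro h
  have tri : ∀ {U : Type _} {G : SimpleGraph U}, G.IsTree →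
      ∀ a b c, G.Adj a b → G.Adj a c → ¬ G.Adj b c := by
    intro U G hG a b c hab hac hbc
    refine hG.isAcyclic.cliqueFree le_rfl {a, b, c} ?_
    exact SimpleGraph.is3Clique_triple_iff.2 ⟨hab, hac, hbc⟩
  obtain ⟨z, y, hz, hy, hsum⟩ := sum_eq_of_geodesicGrowthSeries_eq (tri h₁) (tri h₂) rfl h
  obtain ⟨⟨p₁, hp₁⟩, ⟨q₁, hq₁⟩⟩ := godsilS₁_coalescence_modEq hz
  obtain ⟨⟨p₂, hp₂⟩, ⟨q₂, hq₂⟩⟩ := godsilS₂_coalescence_modEq hy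
  have hin := sum_inl_sub_sum_inl hz hy
  rw [sum_coalescence (r := r), sum_coalescence (r := r)] at hsum
  -- The products of the two root values cancel. The series left are the differences of the constant
  -- parts of the sums, `2 * X ^ 6 - 8 * X ^ 7`, and of the root terms, `X ^ 6 - 3 * X ^ 7`.
  have hdvd : X ^ 8 ∣ X ^ 6 * (2 - 8 * X - (1 - 3 * X) * (z (.inl r) + y (.inl r))) := by
    refine ⟨-p₁ + p₂ - z (.inl r) * q₂ + y (.inl r) * q₁, ?_⟩
    linear_combination hsum - hin - hp₁ + hp₂ - z (.inl r) * hq₂ + y (.inl r) * hq₁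
  rw [pow_add X 6 2, mul_dvd_mul_iff_left (pow_ne_zero _ X_ne_zero), X_pow_dvd_iff] at hdvd
  have hc := hdvd 1 one_lt_two
  have z0 := constantCoeff_of_growthOp_eq_one hz (.inl r)
  have y0 := constantCoeff_of_growthOp_eq_one hy (.inl r)
  have z1 := coeff_one_of_growthOp_eq_one hz (.inl r)
  have y1 := coeff_one_of_growthOp_eq_one hy (.inl r)
  rw [sum_coalescence_adj_root] at z1 y1
  have d₁ : (∑ w, if godsilS₁.Adj 0 w then (1 : ℤ) else 0) = 2 := by
    simp only [godsilS₁_adj_iff]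
    rw [Finset.sum_ite_mem, Finset.univ_inter]
    rfl
  have d₂ : (∑ w, if godsilS₂.Adj 0 w then (1 : ℤ) else 0) = 2 := by
    simp only [godsilS₂_adj_iff]
    rw [Finset.sum_ite_mem, Finset.univ_inter]
    rfl
  have hpos : (1 : ℤ) ≤ ∑ v, if τ.Adj r v then 1 else 0 := by
    obtain ⟨v, hv⟩ := hr
    refine le_trans (by simp [hv]) (Finset.single_le_sum (fun u _ => ?_) (Finset.mem_univ v))
    split_ifs <;> simp
  have hexp : (2 - 8 * X - (1 - 3 * X) * (z (.inl r) + y (.inl r)) : ℤ⟦X⟧) =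
      C 2 - (z (.inl r) + y (.inl r)) + X * (C 3 * (z (.inl r) + y (.inl r)) - C 8) := by
    simp only [map_ofNat]
    ring
  rw [hexp, ← zero_add 1, map_add, coeff_succ_X_mul] at hc
  simp only [coeff_zero_eq_constantCoeff] at z0 y0
  simp only [map_sub, map_add, map_mul, coeff_C, constantCoeff_C, coeff_zero_eq_constantCoeff, z0,
      y0,
    zero_add, z1, y1, d₁, d₂, one_ne_zero, if_false, if_true] at hc
  -- Both linear coefficients are `d + 2 - 3`, with `d` the degree of `r` in `τ`; so `hc` reads `-2
  -- * (d - 1) + 6 - 8 = 0`, against `1 ≤ d`.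
  linarith

end GrowthDiffers

/-! ### Co-spectrality by an explicit intertwining matrix -/

section Cospectral

open Matrix

/-- `P` need not be invertible over `ℤ`: the relation with `Q` makes its determinant nonzero, which
is enough to cancel it in the polynomial ring. -/
theorem charpoly_eq_of_intertwining {ι : Type*} [Fintype ι] [DecidableEq ι] {A B P Q : Matrix ι ι ℤ}
    {k : ℤ} (hk : k ≠ 0) (hQP : Q * P = k • 1) (h : P * A = B * P) : A.charpoly = B.charpoly := by
  have hdet : P.det ≠ 0 := by
    intro h0
    have := congrArg Matrix.det hQP
    rw [det_mul, h0, mul_zero, det_smul, det_one, mul_one] at this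
    exact pow_ne_zero _ hk this.symm
  have hmap : P.map Polynomial.C * charmatrix A = charmatrix B * P.map Polynomial.C := by
    have h' := congrArg (fun M : Matrix ι ι ℤ => M.map Polynomial.C) h
    simp only [Matrix.map_mul] at h'
    simp only [charmatrix, mul_sub, sub_mul, RingHom.mapMatrix_apply, h']
    rw [(Matrix.scalar_commute _ (fun _ => Commute.all _ _) _).eq]
  have hd := congrArg Matrix.det hmap
  rw [det_mul, det_mul, mul_comm] at hd
  refine mul_right_cancel₀ ?_ hd
  have : (P.map Polynomial.C).det = Polynomial.C P.det := (RingHom.map_det Polynomial.C P).symm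
  rw [this]
  simpa using hdet

/-- Seven times an orthogonal matrix that conjugates the adjacency matrices of Godsil's trees, and
fixes the root vector and the all-one vector. -/
def godsilMatrix : Matrix (Fin 11) (Fin 11) ℤ :=
  !![7, 0, 0, 0, 0, 0, 0, 0, 0, 0, 0;
    0, -2, 2, 1, 3, 3, -2, 4, -1, -1, 0;
    0, 3, 4, 2, -1, -1, 3, 1, -2, -2, 0;
    0, 0, 0, 0, 0, 0, 0, 0, 0, 0, 7;
    0, -3, 3, -2, 1, 1, 4, -1, 2, 2, 0;
    0, 1, -1, 3, 2, 2, 1, -2, 4, -3, 0;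
    0, 1, -1, 3, 2, 2, 1, -2, -3, 4, 0;
    0, 2, -2, -1, -3, 4, 2, 3, 1, 1, 0;
    0, -1, 1, 4, -2, -2, -1, 2, 3, 3, 0;
    0, 2, -2, -1, 4, -3, 2, 3, 1, 1, 0;
    0, 4, 3, -2, 1, 1, -3, -1, 2, 2, 0]

theorem godsilMatrix_orthogonal : godsilMatrixᵀ * godsilMatrix = (49 : ℤ) • 1 := by
  decide +kernel

theorem godsilMatrix_sum_row (i : Fin 11) : ∑ j, godsilMatrix i j = 7 := by
  decide +kernel +revert

theorem godsilMatrix_sum_col (j : Fin 11) : ∑ i, godsilMatrix i j = 7 := by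
  decide +kernel +revert

theorem godsilMatrix_zero_left (j : Fin 11) : godsilMatrix 0 j = if j = 0 then 7 else 0 := by
  decide +kernel +revert

theorem godsilMatrix_zero_right (i : Fin 11) : godsilMatrix i 0 = if i = 0 then 7 else 0 := by
  decide +kernel +revert

instance : DecidableRel godsilS₁.Adj := fun a b => decidable_of_iff _ (godsilS₁_adj_iff a b).symm

instance : DecidableRel godsilS₂.Adj := fun a b => decidable_of_iff _ (godsilS₂_adj_iff a b).symm

theorem godsilMatrix_intertwines :
    godsilMatrix * godsilS₁.adjMatrix ℤ = godsilS₂.adjMatrix ℤ * godsilMatrix := by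
  decide +kernel

theorem adjMatrix_compl_eq {V : Type*} [DecidableEq V] (G : SimpleGraph V) [DecidableRel G.Adj]
    [DecidableRel Gᶜ.Adj] :
    Gᶜ.adjMatrix ℤ = (Matrix.of fun _ _ => 1) - 1 - G.adjMatrix ℤ := by
  ext i j
  by_cases hij : i = j
  · subst hij
    simp
  · by_cases h : G.Adj i j <;> simp [hij, h]

theorem cospectral_iff {V W : Type*} [Fintype V] [Fintype W] [DecidableEq V] [DecidableEq W]
    {G : SimpleGraph V} {H : SimpleGraph W} [DecidableRel G.Adj] [DecidableRel H.Adj] :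
    Cospectral G H ↔ (G.adjMatrix ℤ).charpoly = (H.adjMatrix ℤ).charpoly := by
  unfold Cospectral
  convert Iff.rfl

/-- Constant row and column sums make `P` commute with the all-one matrix `J`, and the complement
has adjacency matrix `J - 1 - A`. -/
theorem Cospectral.of_intertwining {V : Type*} [Fintype V] [DecidableEq V] {G H : SimpleGraph V}
    [DecidableRel G.Adj] [DecidableRel H.Adj]
    {P Q : Matrix V V ℤ} {k l : ℤ} (hk : k ≠ 0) (hQP : Q * P = k • 1)
    (h : P * G.adjMatrix ℤ = H.adjMatrix ℤ * P) (hrow : ∀ i, ∑ j, P i j = l)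
    (hcol : ∀ j, ∑ i, P i j = l) : Cospectral G H ∧ Cospectral Gᶜ Hᶜ := by
  refine ⟨cospectral_iff.2 (charpoly_eq_of_intertwining hk hQP h),
    cospectral_iff.2 (charpoly_eq_of_intertwining hk hQP ?_)⟩
  have hJ : P * (Matrix.of fun _ _ => (1 : ℤ)) = (Matrix.of fun _ _ => 1) * P := by
    ext i j
    simp [Matrix.mul_apply, hrow, hcol]
  rw [adjMatrix_compl_eq, adjMatrix_compl_eq, mul_sub, mul_sub, sub_mul, sub_mul, h, hJ, mul_one,
    one_mul]

/-- The extension of `godsilMatrix` to a coalescence by a scalar matrix. -/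
def coalescenceMatrix (V : Type*) [DecidableEq V] :
    Matrix (V ⊕ {w : Fin 11 // w ≠ 0}) (V ⊕ {w : Fin 11 // w ≠ 0}) ℤ :=
  fromBlocks ((7 : ℤ) • 1) 0 0 (godsilMatrix.submatrix Subtype.val Subtype.val)

theorem sum_fin_ne_zero {f : Fin 11 → ℤ} (h : f 0 = 0) :
    ∑ w : {w : Fin 11 // w ≠ 0}, f w = ∑ w, f w := by
  rw [Fintype.sum_eq_add_sum_subtype_ne f 0, h, zero_add]

section Adj

variable {V W : Type*} {τ : SimpleGraph V} {r : V} {H : SimpleGraph W} {s : W}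

theorem coalescence_adj_inl_inl {a b : V} :
    (coalescence τ r H s).Adj (.inl a) (.inl b) ↔ τ.Adj a b := Iff.rfl

theorem coalescence_adj_inl_inr {a : V} {b : {w : W // w ≠ s}} :
    (coalescence τ r H s).Adj (.inl a) (.inr b) ↔ a = r ∧ H.Adj s b := Iff.rfl

theorem coalescence_adj_inr_inl {a : {w : W // w ≠ s}} {b : V} :
    (coalescence τ r H s).Adj (.inr a) (.inl b) ↔ b = r ∧ H.Adj s a := Iff.rfl

theorem coalescence_adj_inr_inr {a b : {w : W // w ≠ s}} :
    (coalescence τ r H s).Adj (.inr a) (.inr b) ↔ H.Adj a b := Iff.rfl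

end Adj

theorem adjMatrix_coalescence {V W : Type*} [DecidableEq V] (τ : SimpleGraph V) (r : V)
    (H : SimpleGraph W) (s : W) [DecidableRel τ.Adj] [DecidableRel H.Adj]
    [DecidableRel (coalescence τ r H s).Adj] :
    (coalescence τ r H s).adjMatrix ℤ = fromBlocks (τ.adjMatrix ℤ)
      (Matrix.of fun v (w : {w : W // w ≠ s}) => if v = r then H.adjMatrix ℤ s w else 0)
      (Matrix.of fun (w : {w : W // w ≠ s}) v => if v = r then H.adjMatrix ℤ w s else 0)
      ((H.adjMatrix ℤ).submatrix Subtype.val Subtype.val) := by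
  ext (i | i) (j | j)
  · simp [coalescence_adj_inl_inl]
  · simp [coalescence_adj_inl_inr, ite_and]
  · simp [coalescence_adj_inr_inl, ite_and, H.adj_comm]
  · simp [coalescence_adj_inr_inr]

-- The off-diagonal blocks match because the root row and column of `godsilMatrix` are 7 times a
-- unit vector, the same scalar 7 as on `V`.
open Classical in
theorem coalescenceMatrix_intertwines {V : Type*} [Fintype V] (τ : SimpleGraph V) (r : V) :
    coalescenceMatrix V * (coalescence τ r godsilS₁ 0).adjMatrix ℤ =
      (coalescence τ r godsilS₂ 0).adjMatrix ℤ * coalescenceMatrix V := by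
  have h : ∀ i j, ∑ k, godsilMatrix i k * godsilS₁.adjMatrix ℤ k j =
      ∑ k, godsilS₂.adjMatrix ℤ i k * godsilMatrix k j := by
    intro i j
    have := congrFun₂ godsilMatrix_intertwines i j
    simpa only [Matrix.mul_apply] using this
  rw [adjMatrix_coalescence, adjMatrix_coalescence, coalescenceMatrix, fromBlocks_multiply,
    fromBlocks_multiply]
  simp only [Matrix.smul_mul, Matrix.mul_smul, Matrix.one_mul, Matrix.mul_one, Matrix.zero_mul,
    Matrix.mul_zero, add_zero, zero_add]
  congr 1
  · ext v w
    have h0 := h 0 w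
    simp only [godsilMatrix_zero_left, ite_mul, zero_mul, Finset.sum_ite_eq', Finset.mem_univ,
      if_true] at h0
    by_cases hv : v = r
    · simp only [Matrix.smul_apply, Matrix.of_apply, hv, if_true, Matrix.mul_apply,
        Matrix.submatrix_apply]
      rw [sum_fin_ne_zero (f := fun k => godsilS₂.adjMatrix ℤ 0 k * godsilMatrix k w), ← h0]
      · rfl
      · simp
    · simp [hv, Matrix.mul_apply]
  · ext w v
    have h0 := h w 0
    simp only [godsilMatrix_zero_right, mul_ite, mul_zero, Finset.sum_ite_eq', Finset.mem_univ,
      if_true] at h0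
    by_cases hv : v = r
    · simp only [Matrix.smul_apply, Matrix.of_apply, hv, if_true, Matrix.mul_apply,
        Matrix.submatrix_apply]
      rw [sum_fin_ne_zero (f := fun k => godsilMatrix w k * godsilS₁.adjMatrix ℤ k 0), h0, mul_comm]
      · rfl
      · simp
    · simp [hv, Matrix.mul_apply]
  · ext w v
    have h0 := h w v
    simp only [Matrix.mul_apply, Matrix.submatrix_apply]
    rw [sum_fin_ne_zero (f := fun k => godsilMatrix w k * godsilS₁.adjMatrix ℤ k v),
      sum_fin_ne_zero (f := fun k => godsilS₂.adjMatrix ℤ w k * godsilMatrix k v)]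
    · exact h0
    · simp [godsilMatrix_zero_left, v.2]
    · simp [godsilMatrix_zero_right, w.2]

open Classical in
theorem coalescenceMatrix_orthogonal (V : Type*) [Fintype V] :
    (coalescenceMatrix V)ᵀ * coalescenceMatrix V = (49 : ℤ) • 1 := by
  rw [coalescenceMatrix, fromBlocks_transpose, fromBlocks_multiply, ← fromBlocks_one,
    fromBlocks_smul]
  congr 1
  · simp
    norm_num
  · simp
  · simp
  · ext i j
    have h := congrFun₂ godsilMatrix_orthogonal i j
    simp only [Matrix.mul_apply, Matrix.transpose_apply] at h
    simp only [Matrix.add_apply, transpose_zero, zero_mul, Matrix.zero_apply,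
      Matrix.mul_apply, Matrix.transpose_apply, Matrix.submatrix_apply]
    rw [sum_fin_ne_zero (f := fun k => godsilMatrix k i * godsilMatrix k j), h]
    · simp [Matrix.one_apply, Subtype.ext_iff]
    · simp [godsilMatrix_zero_left, i.2]

theorem cospectral_coalescence {V : Type*} [Fintype V] (τ : SimpleGraph V) (r : V) :
    Cospectral (coalescence τ r godsilS₁ 0) (coalescence τ r godsilS₂ 0) ∧
      Cospectral (coalescence τ r godsilS₁ 0)ᶜ (coalescence τ r godsilS₂ 0)ᶜ := by
  classical
  refine Cospectral.of_intertwining (k := 49) (by norm_num) (coalescenceMatrix_orthogonal V) (l :=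
      7)
    ?_ ?_ ?_
  · exact coalescenceMatrix_intertwines τ r
  · rintro (i | i)
    · simp only [Fintype.sum_sum_type, coalescenceMatrix, fromBlocks_apply₁₁, fromBlocks_apply₁₂,
        Matrix.smul_apply, Matrix.one_apply]
      simp
    · simp only [Fintype.sum_sum_type, coalescenceMatrix, fromBlocks_apply₂₁, fromBlocks_apply₂₂,
        Matrix.zero_apply, Finset.sum_const_zero, zero_add, Matrix.submatrix_apply]
      rw [sum_fin_ne_zero (f := fun k => godsilMatrix i k), godsilMatrix_sum_row]
      simp [godsilMatrix_zero_right, i.2]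
  · rintro (i | i)
    · simp only [Fintype.sum_sum_type, coalescenceMatrix, fromBlocks_apply₁₁, fromBlocks_apply₂₁,
        Matrix.smul_apply, Matrix.one_apply]
      simp
    · simp only [Fintype.sum_sum_type, coalescenceMatrix, fromBlocks_apply₁₂, fromBlocks_apply₂₂,
        Matrix.zero_apply, Finset.sum_const_zero, zero_add, Matrix.submatrix_apply]
      rw [sum_fin_ne_zero (f := fun k => godsilMatrix k i), godsilMatrix_sum_col]
      simp [godsilMatrix_zero_left, i.2]

end Cospectral

/-! ### Coalescences of trees are trees -/

section Trees

variable {V W : Type*} {τ : SimpleGraph V} {r : V} {H : SimpleGraph W} {s : W}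

open Classical in
/-- The second graph of a coalescence, as a subgraph. -/
noncomputable def coalescenceInr (τ : SimpleGraph V) (r : V) (H : SimpleGraph W) (s : W) :
    H →g coalescence τ r H s where
  toFun w := if h : w = s then .inl r else .inr ⟨w, h⟩
  map_rel' {a b} hab := by
    by_cases ha : a = s <;> by_cases hb : b = s
    · exact absurd (ha.trans hb.symm) hab.ne
    · simpa [ha, hb, coalescence_adj_inl_inr] using ha ▸ hab
    · simpa [ha, hb, coalescence_adj_inr_inl] using hb ▸ hab.symm
    · simpa [ha, hb, coalescence_adj_inr_inr] using hab

theorem coalescenceInr_root : coalescenceInr τ r H s s = .inl r := by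
  simp [coalescenceInr]

theorem coalescenceInr_of_ne (w : {w : W // w ≠ s}) : coalescenceInr τ r H s w = .inr w := by
  simp [coalescenceInr, w.2]

/-- The first graph of a coalescence, as a subgraph. -/
def coalescenceInl (τ : SimpleGraph V) (r : V) (H : SimpleGraph W) (s : W) :
    τ →g coalescence τ r H s where
  toFun := .inl
  map_rel' h := h

theorem coalescence_connected (hτ : τ.Connected) (hH : H.Connected) :
    (coalescence τ r H s).Connected := by
  have key : ∀ x, (coalescence τ r H s).Reachable (.inl r) x := by
    rintro (v | w)
    · exact (hτ.preconnected r v).map (coalescenceInl τ r H s)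
    · have := (hH.preconnected s w).map (coalescenceInr τ r H s)
      rwa [coalescenceInr_root, coalescenceInr_of_ne] at this
  exact { preconnected := fun x y => (key x).symm.trans (key y), nonempty := ⟨.inl r⟩ }

theorem coalescence_edgeSet_subset : (coalescence τ r H s).edgeSet ⊆
    Sym2.map (coalescenceInl τ r H s) '' τ.edgeSet ∪
      Sym2.map (coalescenceInr τ r H s) '' H.edgeSet := by
  intro e
  induction e with
  | h x y =>
    rw [SimpleGraph.mem_edgeSet]
    rcases x with x | x <;> rcases y with y | y <;> intro h
    · exact Or.inl ⟨s(x, y), h, rfl⟩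
    · obtain ⟨rfl, h⟩ := h
      exact Or.inr ⟨s(s, y), h, by simp [coalescenceInr_root, coalescenceInr_of_ne]⟩
    · obtain ⟨rfl, h⟩ := h
      exact Or.inr ⟨s(x.1, s), h.symm, by simp [coalescenceInr_root, coalescenceInr_of_ne]⟩
    · exact Or.inr ⟨s(x.1, y.1), h, by simp [coalescenceInr_of_ne]⟩

theorem card_coalescence [Fintype V] [Fintype W] [DecidableEq W] :
    Fintype.card (V ⊕ {w : W // w ≠ s}) + 1 = Fintype.card V + Fintype.card W := by
  rw [Fintype.card_sum, Fintype.card_subtype_compl, Fintype.card_subtype_eq]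
  have := Fintype.card_pos_iff.2 ⟨s⟩
  omega

/-- Connectedness bounds the number of edges below, and covering the edges by the images of the two
edge sets bounds it above. -/
theorem coalescence_isTree [Finite V] [Finite W] (hτ : τ.IsTree) (hH : H.IsTree) :
    (coalescence τ r H s).IsTree := by
  classical
  have := Fintype.ofFinite V
  have := Fintype.ofFinite W
  have hconn := coalescence_connected (r := r) (s := s) hτ.connected hH.connected
  refine SimpleGraph.isTree_iff_connected_and_card.2 ⟨hconn, le_antisymm ?_
    hconn.card_vert_le_card_edgeSet_add_one⟩
  have h₁ := (SimpleGraph.isTree_iff_connected_and_card.1 hτ).2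
  have h₂ := (SimpleGraph.isTree_iff_connected_and_card.1 hH).2
  have hc := card_coalescence (V := V) (s := s)
  have hle : Nat.card (coalescence τ r H s).edgeSet ≤ Nat.card τ.edgeSet + Nat.card H.edgeSet := by
    simp only [Nat.card_coe_set_eq]
    refine (Set.ncard_le_ncard coalescence_edgeSet_subset (Set.toFinite _)).trans
      ((Set.ncard_union_le _ _).trans (add_le_add ?_ ?_))
    · exact Set.ncard_image_le (Set.toFinite _)
    · exact Set.ncard_image_le (Set.toFinite _)
  simp only [← Nat.card_eq_fintype_card] at hc
  omega

theorem godsilS₁_isTree : godsilS₁.IsTree := by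
  refine SimpleGraph.isTree_iff_connected_and_card.2 ⟨?_, ?_⟩
  · decide +kernel
  · rw [Nat.card_eq_fintype_card, Nat.card_eq_fintype_card]
    decide +kernel

theorem godsilS₂_isTree : godsilS₂.IsTree := by
  refine SimpleGraph.isTree_iff_connected_and_card.2 ⟨?_, ?_⟩
  · decide +kernel
  · rw [Nat.card_eq_fintype_card, Nat.card_eq_fintype_card]
    decide +kernel

end Trees

/-! ### Invariance under isomorphism -/

section Iso

variable {V W : Type*} {G : SimpleGraph V} {H : SimpleGraph W}

theorem leads_map_iff (e : G ≃g H) (a : V) (w : List V) :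
    Leads H (e a) (w.map e) ↔ Leads G a w := by
  induction w with
  | nil => rfl
  | cons c w ih => simp [Leads, ih, e.map_adj_iff]

theorem combReduced_map_iff (e : G ≃g H) (w : List V) :
    CombReduced H (w.map e) ↔ CombReduced G w := by
  induction w with
  | nil => rfl
  | cons c w ih => simp [CombReduced, ih, leads_map_iff]

theorem geodesicGrowthSeries_congr (e : G ≃g H) :
    geodesicGrowthSeries G = geodesicGrowthSeries H := by
  ext m
  simp only [geodesicGrowthSeries, PowerSeries.coeff_mk, geodesicGrowth, isGeodesicWord_iff]
  refine Set.ncard_congr (fun w _ => w.map e) ?_ ?_ ?_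
  · rintro w ⟨h₁, h₂⟩
    exact ⟨by simpa using h₁, (combReduced_map_iff e w).2 h₂⟩
  · intro u w _ _ h
    exact List.map_injective_iff.2 e.injective h
  · rintro w ⟨h₁, h₂⟩
    have hw : (w.map e.symm).map e = w := by simp [Function.comp_def]
    refine ⟨w.map e.symm, ⟨by simpa using h₁, ?_⟩, hw⟩
    rwa [← combReduced_map_iff e, hw]

theorem cospectral_of_iso [Fintype V] [Fintype W] (e : G ≃g H) : Cospectral G H := by
  classical
  rw [cospectral_iff, ← Matrix.charpoly_reindex e.toEquiv]
  congr 1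
  ext i j
  simp only [Matrix.reindex_apply, Matrix.submatrix_apply, SimpleGraph.adjMatrix_apply]
  refine if_congr ?_ rfl rfl
  exact e.symm.map_adj_iff

/-- The complements of isomorphic graphs are isomorphic. -/
def complIso (e : G ≃g H) : Gᶜ ≃g Hᶜ where
  toEquiv := e.toEquiv
  map_rel_iff' {a b} := by
    simp only [SimpleGraph.compl_adj]
    exact and_congr e.injective.ne_iff (not_congr e.map_adj_iff)

end Iso

/-! ### Assembly of the theorem -/

theorem coalescence_godsil {V : Type*} [Fintype V] {τ : SimpleGraph V} {r : V} (hτ : τ.IsTree)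
    (hV : 2 ≤ Fintype.card V) :
    (coalescence τ r godsilS₁ 0).IsTree ∧
      (coalescence τ r godsilS₂ 0).IsTree ∧
      IsEmpty (coalescence τ r godsilS₁ 0 ≃g coalescence τ r godsilS₂ 0) ∧
      Cospectral (coalescence τ r godsilS₁ 0) (coalescence τ r godsilS₂ 0) ∧
      Cospectral (coalescence τ r godsilS₁ 0)ᶜ (coalescence τ r godsilS₂ 0)ᶜ ∧
      geodesicGrowthSeries (coalescence τ r godsilS₁ 0) ≠
        geodesicGrowthSeries (coalescence τ r godsilS₂ 0) := by
  have h₁ := coalescence_isTree (r := r) (s := 0) hτ godsilS₁_isTree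
  have h₂ := coalescence_isTree (r := r) (s := 0) hτ godsilS₂_isTree
  have : Nontrivial V := Fintype.one_lt_card_iff_nontrivial.1 hV
  have hne := geodesicGrowthSeries_coalescence_ne
    (hτ.connected.preconnected.exists_adj_of_nontrivial r) h₁ h₂
  exact ⟨h₁, h₂, ⟨fun e => hne (geodesicGrowthSeries_congr e)⟩, (cospectral_coalescence τ r).1,
    (cospectral_coalescence τ r).2, hne⟩

theorem theorem2 (n : ℕ) (hn : 12 ≤ n) :
    (∀ (V : Type*) [Fintype V] (τ : SimpleGraph V) (r : V),
      τ.IsTree → Fintype.card V + 10 = n →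
        (coalescence τ r godsilS₁ 0).IsTree ∧
        (coalescence τ r godsilS₂ 0).IsTree ∧
        Fintype.card (V ⊕ {w : Fin 11 // w ≠ 0}) = n ∧
        IsEmpty (coalescence τ r godsilS₁ 0 ≃g coalescence τ r godsilS₂ 0) ∧
        Cospectral (coalescence τ r godsilS₁ 0) (coalescence τ r godsilS₂ 0) ∧
        Cospectral (coalescence τ r godsilS₁ 0)ᶜ (coalescence τ r godsilS₂ 0)ᶜ ∧
        geodesicGrowthSeries (coalescence τ r godsilS₁ 0) ≠
          geodesicGrowthSeries (coalescence τ r godsilS₂ 0)) ∧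
    (∃ T₁ T₂ : SimpleGraph (Fin n),
      T₁.IsTree ∧ T₂.IsTree ∧ IsEmpty (T₁ ≃g T₂) ∧
        Cospectral T₁ T₂ ∧ Cospectral T₁ᶜ T₂ᶜ ∧
        geodesicGrowthSeries T₁ ≠ geodesicGrowthSeries T₂) := by
  refine ⟨fun V _ τ r hτ hV => ?_, ?_⟩
  · obtain ⟨h₁, h₂, h₃, h₄, h₅, h₆⟩ := coalescence_godsil (r := r) hτ (by omega)
    have := card_coalescence (V := V) (s := (0 : Fin 11))
    rw [Fintype.card_fin] at this
    exact ⟨h₁, h₂, by omega, h₃, h₄, h₅, h₆⟩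
  -- Any tree on `n - 10` vertices would serve; a star rooted at its centre is taken and the result
  -- is transported to `Fin n`.
  · obtain ⟨m, rfl⟩ : ∃ m, n = m + 1 + 10 := ⟨n - 11, by omega⟩
    obtain ⟨h₁, h₂, h₃, h₄, h₅, h₆⟩ := coalescence_godsil (r := (0 : Fin (m + 1)))
      (SimpleGraph.isTree_starGraph (0 : Fin (m + 1))) (by rw [Fintype.card_fin]; omega)
    have hc := card_coalescence (V := Fin (m + 1)) (s := (0 : Fin 11))
    rw [Fintype.card_fin, Fintype.card_fin] at hc
    let f := Fintype.equivFinOfCardEq (Nat.succ_injective hc)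
    let e₁ := SimpleGraph.Iso.map f (coalescence (SimpleGraph.starGraph 0) 0 godsilS₁ 0)
    let e₂ := SimpleGraph.Iso.map f (coalescence (SimpleGraph.starGraph 0) 0 godsilS₂ 0)
    refine ⟨_, _, e₁.isTree_iff.1 h₁, e₂.isTree_iff.1 h₂,
      ⟨fun e => h₃.false ((e₁.trans e).trans e₂.symm)⟩, ?_, ?_, fun h => h₆ ?_⟩
    · exact ((cospectral_of_iso e₁).symm.trans h₄).trans (cospectral_of_iso e₂)
    · exact ((cospectral_of_iso (complIso e₁)).symm.trans h₅).trans
        (cospectral_of_iso (complIso e₂))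
    · rw [geodesicGrowthSeries_congr e₁, h, ← geodesicGrowthSeries_congr e₂]
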